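/- **Setting.** Let $\beta\ge\sqrt2$ and let $\Omega\subset[1/3,2/3]^2$ be a finite point set. Let $B=[0,1]^2$, and let $P_0$ consist of $\Omega$ and the twelve points that split each edge of $B$ into three equal segments. For a finite set $P$, $\mathrm{lfs}_P(x)$ is the radius of the smallest disk centred at $x$ that touches two points of $P$. Let $\mathcal{QT}$ be a balanced quadtree with root $B$ (the sizes of leaves sharing part of a side differ by a factor of at most $2$) and let $c_{low}>0$, $c_{up}\ge 2c_{low}$ be such that $c_{low}\,\mathrm{size}(\Box)\le \mathrm{lfs}_{P_0}(p)\le c_{up}\,\mathrm{size}(\Box)$ for every leaf $\Box$ and every $p\in P_0\cap\Box$. Here a node of depth $k$ has size $2^{-k}$, and the cells of one depth partition $B$. Let $d_{\mathcal{QT}}$ be the depth of $\mathcal{QT}$, $\alpha=\arcsin\frac1{2\beta}$, $c_{reach}=2c_{up}(2\beta)^{\pi/\alpha}$, and $c_{low}'=c_{shrink}c_{low}$, where $0<c_{shrink}\le1$ is arbitrary. **Loose pairs.** For $p\neq q$ the left (right) leaf of $pq$ is the closed disk through $p,q$ of radius $\beta|pq|$ whose centre lies to the left (right) of $pq$. The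 pair $\langle p,q\rangle$ of points of $P$ is *loose* in $P$ if one of its leaves contains no point of $P$ other than $p,q$; a leaf on a side of $pq$ on which there is no point of $B$ (the outer side of an edge of $B$) does not count. For an empty leaf let $c$ be the point of its boundary furthest from $pq$ (on the side of the leaf's centre), and let the crescent be the closed disk centred at $c$ through $p,q$, minus the leaf. The *off-center* is $c$ if the crescent contains no point of $P$, and otherwise the circumcenter of $pqw$, where $w\in P$ lies in the crescent and the open circumdisk of $pqw$ contains no point of $P$. **Algorithm QT.** Start with $P=P_0$ and all nodes of $\mathcal{QT}$ in a heap. While the heap is not empty, extract a smallest node $\Box$ and treat, in any order, all ordered pairs $(p,q)$ of distinct points of the current $P$ with $p\in\Box$ and $|pq|\le c_{reach}\,\mathrm{size}(\Box)$ (all points are active). A pair is treated as long as it is loose: let $r$ be its off-center for an empty leaf. If $r$ lies inside the diametral circle of no boundary segment (segment between consecutive points of $P$ on an edge of $B$), insert $r$ into $P$; otherwise do not insert $r$, but insert the midpoint of such a segment. With $\rho=|pr|$ for an off-center $r$, and $\rho$ half the length of the split segment for a midpoint, the new point is stored in the deepest cell $\Box'$ containing it with $c_{low}\,\mathrm{size}(\Box')\le\rho\le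 c_{up}\,\mathrm{size}(\Box')$ and $\mathrm{size}(\Box')\ge\mathrm{size}(\Box)$ (in the root if $\rho>c_{up}$). If $\Box'$ is not yet a node, the leaf containing it is split until it is, and the new nodes enter the heap. If $\Box'$ is in the level of $\Box$, it is reinserted into the heap. Stage $i$ ($0\le i\le d_{\mathcal{QT}}$) handles the nodes of depth $d_{\mathcal{QT}}-i$; it begins when no node of larger depth remains in the heap and all pairs of the previous node have been treated. **Claim.** Every execution of the algorithm can be carried on until the heap is empty and all pairs have been treated, and it terminates. Moreover: 1. At the beginning of each stage $i$, every loose pair of $P$ has length at least $c_{low}'/2^{\,d_{\mathcal{QT}}-i+1}$. 2. At the end, the final point set $\mathcal F$ has no loose pairs, and no triangle of its Delaunay triangulation (non-collinear $p,q,r\in\mathcal F$ whose open circumdisk contains no point of $\mathcal F$) is bad, that is, none has a ratio of circumradius to shortest side larger than $\beta$. -/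

import Mathlib

/-! The Euclidean plane is identified with `ℂ`; multiplication by `Complex.I` is the rotation by
a right angle to the left. -/

noncomputable section

namespace QTRefine

/-! ### Loose pairs -/

/-- `p q u` is a left turn: `u` lies strictly to the left of the directed line from `p` to `q`. -/
def LeftTurn (p q u : ℂ) : Prop :=
  0 < (q.re - p.re) * (u.im - p.im) - (q.im - p.im) * (u.re - p.re)

/-- Centre of the left leaf of the flower of `pq`: the point `u` to the left of `pq` with
`|up| = |uq| = β |pq|` (see `leafCenter_spec`). -/
def leafCenter (β : ℝ) (p q : ℂ) : ℂ :=
  (p + q) / 2 + (Real.sqrt (β ^ 2 - 1 / 4) : ℂ) * (Complex.I * (q - p))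

/-- The left leaf of the flower of `pq`, a closed disk.  The right leaf of `pq` is
`leaf β q p`. -/
def leaf (β : ℝ) (p q : ℂ) : Set ℂ := Metric.closedBall (leafCenter β p q) (β * dist p q)

/-- The point on the boundary of the left leaf of `pq` that is furthest from `pq`. -/
def leafTip (β : ℝ) (p q : ℂ) : ℂ :=
  (p + q) / 2 + ((Real.sqrt (β ^ 2 - 1 / 4) + β : ℝ) : ℂ) * (Complex.I * (q - p))

/-- The left crescent of `pq`. -/
def crescent (β : ℝ) (p q : ℂ) : Set ℂ :=
  Metric.closedBall (leafTip β p q) (dist (leafTip β p q) p) \ leaf β p q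

/-- The unit square `B = [0,1]²`. -/
def square : Set ℂ := {z | 0 ≤ z.re ∧ z.re ≤ 1 ∧ 0 ≤ z.im ∧ z.im ≤ 1}

/-- The boundary of the unit square. -/
def squareBoundary : Set ℂ := {z | z ∈ square ∧ (z.re = 0 ∨ z.re = 1 ∨ z.im = 0 ∨ z.im = 1)}

/-- The pair `p q` of vertices of `P` is loose due to its left leaf: this leaf contains no vertex
other than `p` and `q`.  A leaf on the outer side of an edge of the square (that is, on a side of
`pq` that contains no point of the square) does not count. -/
def LooseLeft (β : ℝ) (P : Finset ℂ) (p q : ℂ) : Prop :=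
  p ∈ P ∧ q ∈ P ∧ p ≠ q ∧ (∃ x ∈ square, LeftTurn p q x) ∧
    ∀ x ∈ P, x ∈ leaf β p q → x = p ∨ x = q

/-- `⟨p, q⟩` is a loose pair of `P`: its left or its right leaf is empty. -/
def Loose (β : ℝ) (P : Finset ℂ) (p q : ℂ) : Prop := LooseLeft β P p q ∨ LooseLeft β P q p

/-- `o` and `R` are the centre and the radius of a circle through `p`, `q` and `r`. -/
def IsCircumcircle (o : ℂ) (R : ℝ) (p q r : ℂ) : Prop := dist o p = R ∧ dist o q = R ∧ dist o r = R

/-- `r` is the off-centre of a pair `p q` that is loose due to its left leaf: the tip of the leaf if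
the crescent contains no vertex, and the circumcentre of `p q w` otherwise, where `w` is the
moonstruck of `p q`, i.e. the vertex in the crescent for which the (open) circumdisk of `p q w`
contains no vertex. -/
def IsOffCenter (β : ℝ) (P : Finset ℂ) (p q r : ℂ) : Prop :=
  ((∀ x ∈ P, x ∉ crescent β p q) ∧ r = leafTip β p q) ∨
  (∃ w ∈ P, w ∈ crescent β p q ∧
    ∃ R : ℝ, IsCircumcircle r R p q w ∧ ∀ x ∈ P, R ≤ dist r x)

/-! ### Delaunay triangles and bad triangles -/

/-- `p q r` is a triangle of the Delaunay triangulation of `P`. -/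
def IsDelaunayTriangle (P : Finset ℂ) (p q r : ℂ) : Prop :=
  p ∈ P ∧ q ∈ P ∧ r ∈ P ∧ ¬ Collinear ℝ {p, q, r} ∧
    ∃ o R, IsCircumcircle o R p q r ∧ ∀ x ∈ P, R ≤ dist o x

/-- The ratio of the circumradius of `p q r` to its shortest side is larger than `β`. -/
def IsBadTriangle (β : ℝ) (p q r : ℂ) : Prop :=
  ∃ o R, IsCircumcircle o R p q r ∧ β < R / min (dist p q) (min (dist q r) (dist r p))

/-! ### The boundary of the square -/

/-- The twelve vertices that split each edge of the unit square into three segments. -/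
def boundaryVertices : Finset ℂ := by
  classical
  exact ((Finset.range 4 ×ˢ Finset.range 4).filter
    (fun v => v.1 = 0 ∨ v.1 = 3 ∨ v.2 = 0 ∨ v.2 = 3)).image
      (fun v => (⟨(v.1 : ℝ) / 3, (v.2 : ℝ) / 3⟩ : ℂ))

/-- `a b` is a boundary segment: two consecutive vertices on an edge of the square. -/
def IsBoundarySegment (P : Finset ℂ) (a b : ℂ) : Prop :=
  a ∈ P ∧ b ∈ P ∧ a ≠ b ∧ segment ℝ a b ⊆ squareBoundary ∧
    ∀ x ∈ P, x ∈ segment ℝ a b → x = a ∨ x = b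

/-- `r` encroaches the segment `a b`: it lies inside the diametral circle. -/
def Encroaches (r a b : ℂ) : Prop := dist r ((a + b) / 2) < dist a b / 2

/-- The local feature size at `x` of a set of vertices: the radius of the smallest disk
centred at `x` that touches two of them. -/
def lfs (P : Finset ℂ) (x : ℂ) : ℝ :=
  sInf {ρ : ℝ | ∃ a ∈ P, ∃ b ∈ P, a ≠ b ∧ dist x a ≤ ρ ∧ dist x b ≤ ρ}

/-! ### Quadtrees -/

/-- A dyadic cell: the square `[col/2^depth, (col+1)/2^depth] × [row/2^depth, (row+1)/2^depth]`. -/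
@[ext] structure Cell where
  depth : ℕ
  col : ℕ
  row : ℕ

/-- The unit square as a cell. -/
def Cell.root : Cell := ⟨0, 0, 0⟩

/-- Side length of a cell of depth `k`. -/
def cellSize (k : ℕ) : ℝ := 1 / 2 ^ k

/-- The closed square of a cell. -/
def Cell.region (c : Cell) : Set ℂ :=
  {z | c.col * cellSize c.depth ≤ z.re ∧ z.re ≤ (c.col + 1) * cellSize c.depth ∧
    c.row * cellSize c.depth ≤ z.im ∧ z.im ≤ (c.row + 1) * cellSize c.depth}

/-- The four quadrants of a cell. -/
def Cell.children (c : Cell) : Finset Cell := by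
  classical
  exact (Finset.range 2 ×ˢ Finset.range 2).image
    (fun v => ⟨c.depth + 1, 2 * c.col + v.1, 2 * c.row + v.2⟩)

/-- The cell of depth `k` that contains the point `z` of the unit square.  A point on a common side
of two cells belongs to the right or upper one, so that the cells of one depth partition the
square. -/
def cellAt (k : ℕ) (z : ℂ) : Cell :=
  ⟨k, min ⌊(2 : ℝ) ^ k * z.re⌋₊ (2 ^ k - 1), min ⌊(2 : ℝ) ^ k * z.im⌋₊ (2 ^ k - 1)⟩

/-- `T` is the set of nodes of a quadtree whose root is the unit square. -/
structure IsQuadtree (T : Finset Cell) : Prop where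
  root_mem : Cell.root ∈ T
  parent_mem : ∀ c ∈ T, c = Cell.root ∨ ∃ b ∈ T, c ∈ b.children
  children_subset : ∀ b ∈ T, (∃ c ∈ b.children, c ∈ T) → b.children ⊆ T

/-- A leaf of the quadtree `T`. -/
def IsLeaf (T : Finset Cell) (c : Cell) : Prop := c ∈ T ∧ ∀ b ∈ c.children, b ∉ T

/-- The sizes of two leaves that share (part of) a side differ by a factor of at most two. -/
def IsBalanced (T : Finset Cell) : Prop :=
  ∀ a b, IsLeaf T a → IsLeaf T b → a ≠ b → (a.region ∩ b.region).Nontrivial →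
    a.depth ≤ b.depth + 1

/-- The depth of a quadtree. -/
def treeDepth (T : Finset Cell) : ℕ := T.sup Cell.depth

/-- The leaves of `T` approximate the local feature size of the vertices in them. -/
def ApproximatesLfs (T : Finset Cell) (P : Finset ℂ) (cLow cUp : ℝ) : Prop :=
  ∀ c, IsLeaf T c → ∀ p ∈ P, cellAt c.depth p = c →
    cLow * cellSize c.depth ≤ lfs P p ∧ lfs P p ≤ cUp * cellSize c.depth

/-! ### The algorithm -/

/-- The small angle threshold `α`. -/
def smallAngle (β : ℝ) : ℝ := Real.arcsin (1 / (2 * β))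

/-- `c_gbu = (2β)^(π/α)`. -/
def cGbu (β : ℝ) : ℝ := (2 * β) ^ (Real.pi / smallAngle β)

/-- `c_reach = 2 c_up c_gbu`. -/
def cReach (β cUp : ℝ) : ℝ := 2 * cUp * cGbu β

/-- A state of the algorithm. -/
structure State where
  /-- the current point set `P` -/
  vertices : Finset ℂ
  /-- the nodes of the quadtree -/
  nodes : Finset Cell
  /-- the nodes in the heap -/
  heap : Finset Cell
  /-- the depth of the node that was extracted last -/
  level : ℕ
  /-- the pairs that the two `for` loops have still to treat for the node extracted last -/
  pending : Finset (ℂ × ℂ)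

/-- The initial state: the vertices are the input points and the vertices on the boundary of the
square, and all nodes of the quadtree are in the heap. -/
def initState (Ω : Finset ℂ) (T : Finset Cell) : State := by
  classical
  exact ⟨Ω ∪ boundaryVertices, T, T, treeDepth T, ∅⟩

/-- The pairs treated when the node `c` is extracted. -/
def pairsFor (β cUp : ℝ) (P : Finset ℂ) (c : Cell) : Finset (ℂ × ℂ) := by
  classical
  exact (P ×ˢ P).filter (fun v => cellAt c.depth v.1 = c ∧ v.1 ≠ v.2 ∧
    dist v.1 v.2 ≤ cReach β cUp * cellSize c.depth)

/-- Extract the node `c` from the heap. -/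
def State.extract (β cUp : ℝ) (s : State) (c : Cell) : State := by
  classical
  exact ⟨s.vertices, s.nodes, s.heap.erase c, c.depth, pairsFor β cUp s.vertices c⟩

/-- The `for` loops are done with the pair `v`. -/
def State.discard (s : State) (v : ℂ × ℂ) : State := by
  classical
  exact { s with pending := s.pending.erase v }

/-- `k` is the depth of the cell in which a new vertex at distance `ρ` from the nearest vertices is
stored when a node of depth `j` is treated: the cell is as low as possible with
`c_low size ≤ ρ ≤ c_up size` and is not smaller than the node.  If `ρ` is too large even for the
root, then the vertex is stored in the root. -/
def IsStorageDepth (cLow cUp : ℝ) (j : ℕ) (ρ : ℝ) (k : ℕ) : Prop :=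
  IsGreatest {m : ℕ | m ≤ j ∧ cLow * cellSize m ≤ ρ ∧ ρ ≤ cUp * cellSize m} k ∨
    (cUp < ρ ∧ k = 0)

/-- Insert the vertex `x` and store it in its cell of depth `k`.  If this cell is not a node of the
quadtree yet, then the leaf that contains it is split until it is, and the new nodes are put into
the heap.  If the cell is in the level of the node being treated, it is put into the heap again. -/
def State.insert (s : State) (x : ℂ) (k : ℕ) : State := by
  classical
  exact
    let new := ((Finset.range k).biUnion fun m => (cellAt m x).children) \ s.nodes
    { s with
      vertices := Insert.insert x s.vertices
      nodes := s.nodes ∪ new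
      heap := s.heap ∪ new ∪ (if k = s.level then {cellAt k x} else ∅) }

/-- One step of the algorithm.  The order of extraction among nodes of equal depth, the order of
the `for` loops, and the choices of an empty leaf and of an encroached segment are arbitrary. -/
inductive Step (β cLow cUp : ℝ) : State → State → Prop
  /-- extract a smallest node from the heap -/
  | extract (s : State) (c : Cell) (hs : s.pending = ∅) (hc : c ∈ s.heap)
      (hmin : ∀ b ∈ s.heap, b.depth ≤ c.depth) :
      Step β cLow cUp s (s.extract β cUp c)
  /-- a pair that is not loose needs no treatment -/
  | discard (s : State) (p q : ℂ) (hpq : (p, q) ∈ s.pending) (hn : ¬ Loose β s.vertices p q) :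
      Step β cLow cUp s (s.discard (p, q))
  /-- insert an off-centre of a loose pair that encroaches no boundary segment -/
  | insert (s : State) (p q a b r : ℂ) (k : ℕ) (hpq : (p, q) ∈ s.pending)
      (hab : (a = p ∧ b = q) ∨ (a = q ∧ b = p)) (hl : LooseLeft β s.vertices a b)
      (hr : IsOffCenter β s.vertices a b r)
      (hfree : ∀ e f, IsBoundarySegment s.vertices e f → ¬ Encroaches r e f)
      (hk : IsStorageDepth cLow cUp s.level (dist p r) k) :
      Step β cLow cUp s (s.insert r k)
  /-- if the off-centre encroaches a boundary segment, then it is not inserted, and this segment is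
  split in the middle instead -/
  | split (s : State) (p q a b r e f : ℂ) (k : ℕ) (hpq : (p, q) ∈ s.pending)
      (hab : (a = p ∧ b = q) ∨ (a = q ∧ b = p)) (hl : LooseLeft β s.vertices a b)
      (hr : IsOffCenter β s.vertices a b r)
      (hef : IsBoundarySegment s.vertices e f) (henc : Encroaches r e f)
      (hk : IsStorageDepth cLow cUp s.level (dist e f / 2) k) :
      Step β cLow cUp s (s.insert ((e + f) / 2) k)

/-- The state `s` occurs in some execution on the input `Ω` with initial quadtree `T`. -/
def Reachable (β cLow cUp : ℝ) (Ω : Finset ℂ) (T : Finset Cell) (s : State) : Prop :=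
  Relation.ReflTransGen (Step β cLow cUp) (initState Ω T) s

/-- The execution has ended. -/
def State.Final (s : State) : Prop := s.heap = ∅ ∧ s.pending = ∅

/-- All nodes of depth larger than `d - i` have been handled.  In stage `i` the nodes of depth
`d - i` are handled, so the beginning of stage `i` is the first such state of an execution. -/
def State.AtStage (s : State) (d i : ℕ) : Prop :=
  s.pending = ∅ ∧ ∀ c ∈ s.heap, c.depth ≤ d - i

/-! ### The explicit leaf centre is the one described -/

theorem leafCenter_spec (β : ℝ) (hβ : 1 / 2 < β) (p q : ℂ) (hpq : p ≠ q) :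
    LeftTurn p q (leafCenter β p q) ∧ dist (leafCenter β p q) p = β * dist p q ∧
      dist (leafCenter β p q) q = β * dist p q := by
  have h0 : 0 < β ^ 2 - 1 / 4 := by nlinarith
  have hβ0 : 0 ≤ β := by linarith
  have hn : 0 < (p.re - q.re) ^ 2 + (p.im - q.im) ^ 2 := by
    by_contra hcon
    apply hpq
    apply Complex.ext <;> nlinarith [sq_nonneg (p.re - q.re), sq_nonneg (p.im - q.im)]
  obtain ⟨t, hs, hs2, hc⟩ : ∃ t : ℝ, 0 < t ∧ t ^ 2 = β ^ 2 - 1 / 4 ∧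
      leafCenter β p q = (p + q) / 2 + (t : ℂ) * (Complex.I * (q - p)) :=
    ⟨_, Real.sqrt_pos.2 h0, Real.sq_sqrt h0.le, rfl⟩
  have hre : (leafCenter β p q).re = (p.re + q.re) / 2 - t * (q.im - p.im) := by
    rw [hc]; simp; ring
  have him : (leafCenter β p q).im = (p.im + q.im) / 2 + t * (q.re - p.re) := by
    rw [hc]; simp
  have hR : β * dist p q = Real.sqrt (β ^ 2 * ((p.re - q.re) ^ 2 + (p.im - q.im) ^ 2)) := by
    rw [Real.sqrt_mul (sq_nonneg β), Real.sqrt_sq hβ0, Complex.dist_eq_re_im]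
  refine ⟨?_, ?_, ?_⟩
  · unfold LeftTurn
    rw [hre, him]
    nlinarith [mul_pos hs hn]
  · rw [hR, Complex.dist_eq_re_im, hre, him]
    congr 1
    linear_combination ((p.re - q.re) ^ 2 + (p.im - q.im) ^ 2) * hs2
  · rw [hR, Complex.dist_eq_re_im, hre, him]
    congr 1
    linear_combination ((p.re - q.re) ^ 2 + (p.im - q.im) ^ 2) * hs2

end QTRefine

end

noncomputable section

namespace QTRefine

/-! ### Circles through two points -/

/-! The argument is an invariant of the execution, supported by three geometric facts.

The invariant `Invariant.untreated` says that every loose pair is still scheduled: it has an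
endpoint stored at a depth `k` with `cLow * cellSize k` at most the length of the pair, and at each
depth from `k` up to the root the cell of that endpoint is in the heap, or the pair is pending, or
it exceeds the reach there. Extraction preserves this because it makes all pairs within reach
pending. Insertion preserves it because old pairs never become loose (`Loose.anti`), while a pair
containing the new vertex is at least as long as the radius `ρ` that determines the storage cell. As
the reach at depth `l + 1` is at least `cLow * cellSize l`, loose pairs have length at least `cLow`
times the current cell size (`Invariant.le_dist`). At the root the reach is at least 2, which
exceeds the diameter of the square, so a final state has no loose pair.

Off-centers (`IsOffCenter.exists_axisPoint`): an off-center is the centre of a disk through the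
pair, with no vertex in its interior and of radius at least `β` times the length of the pair. This
radius loses at most a factor `√2 ≤ β` when a boundary segment is split instead
(`Encroaches.radius_le`), so a storage cell always exists. The storage rule keeps all vertices `cLow
* cellSize d` apart, and packing gives termination.

Boundary (`Unencroached.mem_interior`): as long as no vertex encroaches a boundary segment, an
off-center that encroaches none lies in the interior of the square. Both kinds of insertion preserve
this condition.

Bad triangles (`not_empty_beyond_leaf`): a bad Delaunay triangle gives an empty circle through two
vertices whose centre is beyond the centre of their leaf. If that leaf is not empty, the circle can
be lowered until it yields a shorter pair of the same kind; a shortest such pair is therefore loose.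
-/

theorem dist_sq_eq (a b : ℂ) : dist a b ^ 2 = (a.re - b.re) ^ 2 + (a.im - b.im) ^ 2 := by
  rw [Complex.dist_eq_re_im, Real.sq_sqrt (by positivity)]

theorem dist_le_dist_iff (a b c d : ℂ) : dist a b ≤ dist c d ↔
    (a.re - b.re) ^ 2 + (a.im - b.im) ^ 2 ≤ (c.re - d.re) ^ 2 + (c.im - d.im) ^ 2 := by
  rw [← dist_sq_eq, ← dist_sq_eq, sq_le_sq₀ dist_nonneg dist_nonneg]

theorem sq_dist_pos {p q : ℂ} (h : p ≠ q) : 0 < (p.re - q.re) ^ 2 + (p.im - q.im) ^ 2 := by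
  rw [← dist_sq_eq]
  exact pow_pos (dist_pos.2 h) 2

/-- The point at signed height `t |pq|` on the perpendicular bisector of `pq`. -/
def axisPoint (t : ℝ) (p q : ℂ) : ℂ := (p + q) / 2 + (t : ℂ) * (Complex.I * (q - p))

/-- Twice the signed area of the triangle `p q x`. -/
def cross (p q x : ℂ) : ℝ := (q.re - p.re) * (x.im - p.im) - (q.im - p.im) * (x.re - p.re)

/-- The power of `x` with respect to the diametral circle of `p q`. -/
def diamPower (p q x : ℂ) : ℝ :=
  (x.re - p.re) * (x.re - q.re) + (x.im - p.im) * (x.im - q.im)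

/-- The height of the centre of a leaf. -/
def leafHeight (β : ℝ) : ℝ := Real.sqrt (β ^ 2 - 1 / 4)

theorem axisPoint_re (t : ℝ) (p q : ℂ) :
    (axisPoint t p q).re = (p.re + q.re) / 2 - t * (q.im - p.im) := by
  simp [axisPoint]; ring

theorem axisPoint_im (t : ℝ) (p q : ℂ) :
    (axisPoint t p q).im = (p.im + q.im) / 2 + t * (q.re - p.re) := by
  simp [axisPoint]

/-- The circles through `p` and `q` form a pencil: membership of `x` in the disk centred at height
`t` depends only on the sign of `diamPower p q x - 2 * t * cross p q x`, which is affine in `t`.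
Leaves, crescents and empty circles are all compared through this inequality. -/
theorem axisPoint_dist_sq (t : ℝ) (p q x : ℂ) : dist (axisPoint t p q) x ^ 2 =
    (t ^ 2 + 1 / 4) * dist p q ^ 2 + (diamPower p q x - 2 * t * cross p q x) := by
  rw [dist_sq_eq, dist_sq_eq, axisPoint_re, axisPoint_im, diamPower, cross]
  ring

theorem axisPoint_dist_left_sq (t : ℝ) (p q : ℂ) : dist (axisPoint t p q) p ^ 2 =
    (t ^ 2 + 1 / 4) * dist p q ^ 2 := by
  rw [axisPoint_dist_sq, diamPower, cross]; ring

theorem axisPoint_dist_right (t : ℝ) (p q : ℂ) :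
    dist (axisPoint t p q) q = dist (axisPoint t p q) p := by
  rw [← sq_eq_sq₀ dist_nonneg dist_nonneg, axisPoint_dist_left_sq, axisPoint_dist_sq,
    diamPower, cross]
  ring

theorem axisPoint_dist_le_iff (t : ℝ) (p q x : ℂ) :
    dist (axisPoint t p q) p ≤ dist (axisPoint t p q) x ↔
      2 * t * cross p q x ≤ diamPower p q x := by
  rw [← sq_le_sq₀ dist_nonneg dist_nonneg, axisPoint_dist_left_sq, axisPoint_dist_sq]
  constructor <;> intro h <;> linarith

theorem axisPoint_le_dist_iff (t : ℝ) (p q x : ℂ) :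
    dist (axisPoint t p q) x ≤ dist (axisPoint t p q) p ↔
      diamPower p q x ≤ 2 * t * cross p q x := by
  rw [← sq_le_sq₀ dist_nonneg dist_nonneg, axisPoint_dist_left_sq, axisPoint_dist_sq]
  constructor <;> intro h <;> linarith

theorem exists_eq_axisPoint {p q r : ℂ} (hpq : p ≠ q) (h : dist r p = dist r q) :
    ∃ t : ℝ, r = axisPoint t p q := by
  have hn := sq_dist_pos hpq
  have h2 : (r.re - p.re) ^ 2 + (r.im - p.im) ^ 2 = (r.re - q.re) ^ 2 + (r.im - q.im) ^ 2 := by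
    rw [← dist_sq_eq, ← dist_sq_eq, h]
  refine ⟨((r.im - (p.im + q.im) / 2) * (q.re - p.re) - (r.re - (p.re + q.re) / 2) *
    (q.im - p.im)) / ((p.re - q.re) ^ 2 + (p.im - q.im) ^ 2), Complex.ext ?_ ?_⟩
  · rw [axisPoint_re]
    field_simp
    linear_combination (-(p.re - q.re)) * h2
  · rw [axisPoint_im]
    field_simp
    linear_combination (-(p.im - q.im)) * h2

theorem cross_axisPoint (t : ℝ) (p q : ℂ) : cross p q (axisPoint t p q) = t * dist p q ^ 2 := by
  rw [cross, axisPoint_re, axisPoint_im, dist_sq_eq]; ring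

theorem leafCenter_eq (β : ℝ) (p q : ℂ) : leafCenter β p q = axisPoint (leafHeight β) p q := rfl

theorem leafTip_eq (β : ℝ) (p q : ℂ) : leafTip β p q = axisPoint (leafHeight β + β) p q := rfl

theorem leafHeight_sq {β : ℝ} (hβ : 1 / 2 < β) : leafHeight β ^ 2 = β ^ 2 - 1 / 4 :=
  Real.sq_sqrt (by nlinarith)

theorem leafHeight_pos {β : ℝ} (hβ : 1 / 2 < β) : 0 < leafHeight β :=
  Real.sqrt_pos.2 (by nlinarith)

theorem mul_dist_le_axisPoint_dist {β t : ℝ} (hβ : 1 / 2 < β) (ht : leafHeight β ≤ t) (p q : ℂ) :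
    β * dist p q ≤ dist (axisPoint t p q) p := by
  have h0 := leafHeight_pos hβ
  rw [← sq_le_sq₀ (mul_nonneg (by linarith) dist_nonneg) dist_nonneg, axisPoint_dist_left_sq,
    mul_pow]
  gcongr
  nlinarith [leafHeight_sq hβ]

theorem mem_leaf_iff {β : ℝ} (hβ : 1 / 2 < β) (p q x : ℂ) :
    x ∈ leaf β p q ↔ diamPower p q x ≤ 2 * leafHeight β * cross p q x := by
  have h : β * dist p q = dist (axisPoint (leafHeight β) p q) p := by
    rw [← sq_eq_sq₀ (mul_nonneg (by linarith) dist_nonneg) dist_nonneg, axisPoint_dist_left_sq,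
      leafHeight_sq hβ]
    ring
  rw [leaf, Metric.mem_closedBall, dist_comm, leafCenter_eq, h, axisPoint_le_dist_iff]

theorem mem_crescent_iff {β : ℝ} (hβ : 1 / 2 < β) (p q x : ℂ) :
    x ∈ crescent β p q ↔ diamPower p q x ≤ 2 * (leafHeight β + β) * cross p q x ∧
      2 * leafHeight β * cross p q x < diamPower p q x := by
  rw [crescent, Set.mem_sdiff, Metric.mem_closedBall, dist_comm x, leafTip_eq,
    axisPoint_le_dist_iff, mem_leaf_iff hβ, not_le]

theorem LooseLeft.lt_diamPower {β : ℝ} (hβ : 1 / 2 < β) {P : Finset ℂ} {p q x : ℂ}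
    (h : LooseLeft β P p q) (hx : x ∈ P) (hxp : x ≠ p) (hxq : x ≠ q) :
    2 * leafHeight β * cross p q x < diamPower p q x := by
  by_contra! hc
  rcases h.2.2.2.2 x hx ((mem_leaf_iff hβ p q x).2 hc) with h | h
  exacts [hxp h, hxq h]

theorem diamPower_left (p q : ℂ) : diamPower p q p = 0 := by rw [diamPower]; ring

theorem diamPower_right (p q : ℂ) : diamPower p q q = 0 := by rw [diamPower]; ring

theorem cross_left (p q : ℂ) : cross p q p = 0 := by rw [cross]; ring

theorem cross_right (p q : ℂ) : cross p q q = 0 := by rw [cross]; ring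

/-! ### Off-centres -/

/-- An off-centre lies on the bisector beyond the centre of the leaf, and is at least as far from
all vertices as from the pair. -/
theorem IsOffCenter.exists_axisPoint {β : ℝ} (hβ : 1 / 2 < β) {P : Finset ℂ} {p q r : ℂ}
    (hl : LooseLeft β P p q) (hr : IsOffCenter β P p q r) :
    ∃ t, leafHeight β ≤ t ∧ r = axisPoint t p q ∧ ∀ x ∈ P, dist r p ≤ dist r x := by
  have h0 := leafHeight_pos hβ
  rcases hr with ⟨he, rfl⟩ | ⟨w, hw, hwc, R, ⟨h1, h2, h3⟩, he⟩
  · refine ⟨leafHeight β + β, by linarith, rfl, fun x hx => ?_⟩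
    rw [leafTip_eq, axisPoint_dist_le_iff]
    by_cases hxp : x = p
    · rw [hxp, cross_left, diamPower_left, mul_zero]
    by_cases hxq : x = q
    · rw [hxq, cross_right, diamPower_right, mul_zero]
    have h := he x hx
    rw [mem_crescent_iff hβ] at h
    by_contra! hc
    exact h ⟨hc.le, hl.lt_diamPower hβ hx hxp hxq⟩
  · obtain ⟨t, rfl⟩ := exists_eq_axisPoint hl.2.2.1 (h1.trans h2.symm)
    refine ⟨t, ?_, rfl, fun x hx => h1.trans_le (he x hx)⟩
    have hwt := (axisPoint_le_dist_iff t p q w).1 (by rw [h3, h1])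
    obtain ⟨hw1, hw2⟩ := (mem_crescent_iff hβ p q w).1 hwc
    -- The two crescent inequalities differ by `2 * β * cross p q w`, which is thus positive.
    have hc : 0 < cross p q w := by
      by_contra! hc
      nlinarith
    by_contra! ht
    nlinarith

/-- If the crescent is occupied, the moonstruck is its vertex with the lowest circumcentre, that is,
with the least ratio of `diamPower` to `cross`. The resulting disk lies in the union of leaf and
crescent on the left of the pair, and in the leaf on the right. -/
theorem LooseLeft.exists_isOffCenter {β : ℝ} (hβ : 1 / 2 < β) {P : Finset ℂ} {p q : ℂ}
    (hl : LooseLeft β P p q) : ∃ r, IsOffCenter β P p q r := by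
  classical
  by_cases he : ∀ x ∈ P, x ∉ crescent β p q
  · exact ⟨_, Or.inl ⟨he, rfl⟩⟩
  push Not at he
  obtain ⟨w0, hw0, hwc0⟩ := he
  obtain ⟨w, hw, hmin⟩ := Finset.exists_min_image (P.filter (· ∈ crescent β p q))
    (fun x => diamPower p q x / cross p q x) ⟨w0, Finset.mem_filter.2 ⟨hw0, hwc0⟩⟩
  obtain ⟨hw, hwc⟩ := Finset.mem_filter.1 hw
  have cpos : ∀ x, x ∈ crescent β p q → 0 < cross p q x := by
    intro x hx
    obtain ⟨h1, h2⟩ := (mem_crescent_iff hβ p q x).1 hx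
    by_contra! hc
    nlinarith
  have hcw := cpos w hwc
  obtain ⟨hw1, hw2⟩ := (mem_crescent_iff hβ p q w).1 hwc
  obtain ⟨t, ht⟩ : ∃ t, t = diamPower p q w / cross p q w / 2 := ⟨_, rfl⟩
  have htw : diamPower p q w = 2 * t * cross p q w := by rw [ht]; field_simp
  have hts : leafHeight β < t := by
    by_contra! h
    nlinarith
  have htb : t ≤ leafHeight β + β := by
    by_contra! h
    nlinarith
  refine ⟨axisPoint t p q, Or.inr ⟨w, hw, hwc, dist (axisPoint t p q) p,
    ⟨rfl, axisPoint_dist_right t p q, ?_⟩, fun x hx => ?_⟩⟩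
  · exact le_antisymm ((axisPoint_le_dist_iff t p q w).2 htw.le)
      ((axisPoint_dist_le_iff t p q w).2 htw.ge)
  · rw [axisPoint_dist_le_iff]
    by_cases hxp : x = p
    · rw [hxp, cross_left, diamPower_left, mul_zero]
    by_cases hxq : x = q
    · rw [hxq, cross_right, diamPower_right, mul_zero]
    have h := hl.lt_diamPower hβ hx hxp hxq
    by_contra! hc
    have hcx : 0 < cross p q x := by
      by_contra! hcx
      nlinarith
    have hxc : x ∈ crescent β p q := (mem_crescent_iff hβ p q x).2 ⟨by nlinarith, h⟩
    have := hmin x (Finset.mem_filter.2 ⟨hx, hxc⟩)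
    rw [le_div_iff₀ hcx] at this
    have h2 : diamPower p q w / cross p q w = 2 * t := by rw [ht]; ring
    rw [h2] at this
    linarith

/-! ### Bad triangles -/

theorem eq_of_cross_eq_zero {p q x : ℂ} (hpq : p ≠ q) (hc : cross p q x = 0)
    (hd : diamPower p q x = 0) : x = p ∨ x = q := by
  have hn := sq_dist_pos hpq
  rw [cross] at hc
  rw [diamPower] at hd
  -- Lagrange's identity: `diamPower` and `cross` are the inner and outer products of `x - p` and `x
  -- - q`.
  have key : ((x.re - p.re) ^ 2 + (x.im - p.im) ^ 2) *
      ((x.re - q.re) ^ 2 + (x.im - q.im) ^ 2) = 0 := by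
    linear_combination (((x.re - p.re) * (x.re - q.re) + (x.im - p.im) * (x.im - q.im)) * hd +
      ((q.re - p.re) * (x.im - p.im) - (q.im - p.im) * (x.re - p.re)) * hc)
  rcases mul_eq_zero.1 key with h | h
  · left
    by_contra hne
    exact (sq_dist_pos hne).ne' h
  · right
    by_contra hne
    exact (sq_dist_pos hne).ne' h

theorem dist_sq_add_dist_sq (p q x : ℂ) :
    dist x p ^ 2 + dist x q ^ 2 = dist p q ^ 2 + 2 * diamPower p q x := by
  simp only [dist_sq_eq, diamPower]; ring

/-- If there are no loose pairs, then no empty circle through two vertices, with a vertex to the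
left, has its centre beyond the centre of the left leaf. -/
theorem not_empty_beyond_leaf {β : ℝ} (hβ : 1 / 2 < β) {P : Finset ℂ}
    (hP : ∀ x ∈ P, x ∈ square) (hno : ∀ p q : ℂ, ¬ Loose β P p q) {p q r : ℂ} (hp : p ∈ P)
    (hq : q ∈ P) (hr : r ∈ P) (hc : 0 < cross p q r) {t : ℝ} (ht : leafHeight β < t)
    (he : ∀ x ∈ P, 2 * t * cross p q x ≤ diamPower p q x) : False := by
  classical
  have h0 := leafHeight_pos hβ
  -- Descent on the length: a shortest pair with an empty circle of this kind is taken.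
  obtain ⟨v, hv, hmin⟩ := Finset.exists_min_image ((P ×ˢ P).filter fun v =>
    (∃ r ∈ P, 0 < cross v.1 v.2 r) ∧ ∃ t, leafHeight β < t ∧
      ∀ x ∈ P, 2 * t * cross v.1 v.2 x ≤ diamPower v.1 v.2 x) (fun v => dist v.1 v.2)
    ⟨(p, q), by simp only [Finset.mem_filter, Finset.mem_product]
                exact ⟨⟨hp, hq⟩, ⟨r, hr, hc⟩, t, ht, he⟩⟩
  clear hc he ht hp hq hr
  simp only [Finset.mem_filter, Finset.mem_product] at hv hmin
  obtain ⟨p, q⟩ := v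
  obtain ⟨⟨hp, hq⟩, ⟨r, hr, hc⟩, t, ht, he⟩ := hv
  dsimp only at hp hq hc he hmin
  have hpq : p ≠ q := by
    rintro rfl
    rw [cross] at hc
    linarith
  have hex : ∃ x ∈ P, x ∈ leaf β p q ∧ x ≠ p ∧ x ≠ q := by
    by_contra! hcon
    refine hno p q (Or.inl ⟨hp, hq, hpq, ⟨r, hP r hr, hc⟩, fun x hx hxl => ?_⟩)
    by_cases hxp : x = p
    · exact Or.inl hxp
    · exact Or.inr (hcon x hx hxl hxp)
  obtain ⟨y, hy, hyl, hyp, hyq⟩ := hex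
  rw [mem_leaf_iff hβ] at hyl
  -- To the left of `pq` the leaf is inside the larger empty disk, so a vertex of the leaf other
  -- than `p` and `q` lies to the right.
  have hcy : cross p q y < 0 := by
    rcases lt_trichotomy (cross p q y) 0 with h | h | h
    · exact h
    · have h1 := he y hy
      rw [h, mul_zero] at h1 hyl
      rcases eq_of_cross_eq_zero hpq h (le_antisymm hyl h1) with h | h
      exacts [(hyp h).elim, (hyq h).elim]
    · have h1 := he y hy
      nlinarith
  -- The centre is lowered along the bisector until the circle first meets a vertex `x` to the right
  -- of `pq`. This happens at a height `u` between that of the leaf centre and `t`, and the circle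
  -- stays empty.
  obtain ⟨x, hx, hmax⟩ := Finset.exists_max_image (P.filter fun x => cross p q x < 0)
    (fun x => diamPower p q x / (2 * cross p q x)) ⟨y, Finset.mem_filter.2 ⟨hy, hcy⟩⟩
  obtain ⟨hx, hcx⟩ := Finset.mem_filter.1 hx
  obtain ⟨u, hu⟩ : ∃ u, u = diamPower p q x / (2 * cross p q x) := ⟨_, rfl⟩
  rw [← hu] at hmax
  have hux : diamPower p q x = 2 * u * cross p q x := by
    have := hcx.ne
    rw [hu]; field_simp
  have hus : leafHeight β ≤ u := by
    refine le_trans ?_ (hmax y (Finset.mem_filter.2 ⟨hy, hcy⟩))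
    rw [le_div_iff_of_neg (by linarith)]
    linarith
  have hut : u ≤ t := by
    have := he x hx
    rw [hux] at this
    by_contra! h
    nlinarith
  have hemp : ∀ z ∈ P, 2 * u * cross p q z ≤ diamPower p q z := by
    intro z hz
    rcases lt_trichotomy (cross p q z) 0 with h | h | h
    · have := hmax z (Finset.mem_filter.2 ⟨hz, h⟩)
      rw [div_le_iff_of_neg (by linarith)] at this
      linarith
    · have := he z hz
      rw [h] at this ⊢
      linarith
    · have := he z hz
      nlinarith
  -- The centre is to the left of `pq` and `x` to the right, so the angle at `x` is obtuse and `px`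
  -- is shorter than `pq`.
  have hdx : diamPower p q x < 0 := by
    rw [hux]
    nlinarith
  have hsum := dist_sq_add_dist_sq p q x
  have hxp : x ≠ p := by
    rintro rfl
    rw [diamPower_left] at hdx
    exact lt_irrefl _ hdx
  have hxq : x ≠ q := by
    rintro rfl
    rw [diamPower_right] at hdx
    exact lt_irrefl _ hdx
  have hxq0 := dist_pos.2 hxq
  have hlt : dist p x < dist p q := by
    rw [dist_comm p x, ← sq_lt_sq₀ dist_nonneg dist_nonneg]
    nlinarith
  have hox : dist (axisPoint u p q) p = dist (axisPoint u p q) x :=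
    le_antisymm ((axisPoint_dist_le_iff u p q x).2 hux.ge)
      ((axisPoint_le_dist_iff u p q x).2 hux.le)
  obtain ⟨w, hw⟩ := exists_eq_axisPoint hxp.symm hox
  have hcq : 0 < cross p x q := by
    have : cross p x q = - cross p q x := by simp only [cross]; ring
    linarith
  have hdq : 0 < diamPower p x q := by
    have : diamPower p x q = dist x q ^ 2 - diamPower p q x := by
      rw [dist_sq_eq]; simp only [diamPower]; ring
    nlinarith
  have hwq : diamPower p x q = 2 * w * cross p x q := by
    have h := axisPoint_dist_right u p q
    rw [hw] at h
    exact le_antisymm ((axisPoint_le_dist_iff w p x q).1 h.le)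
      ((axisPoint_dist_le_iff w p x q).1 h.ge)
  have hw0 : 0 < w := by
    by_contra! h
    nlinarith
  -- The same circle seen from the shorter chord `px`: its centre is relatively higher, so `(p, x)`
  -- with `q` to its left contradicts minimality.
  have hws : leafHeight β < w := by
    have h1 := axisPoint_dist_left_sq u p q
    rw [hw, axisPoint_dist_left_sq] at h1
    have h2 : dist p x ^ 2 < dist p q ^ 2 := by
      rwa [sq_lt_sq₀ dist_nonneg dist_nonneg]
    have h3 : 0 < dist p x ^ 2 := pow_pos (dist_pos.2 hxp.symm) 2
    by_contra! h
    have h4 : w ^ 2 ≤ u ^ 2 := by nlinarith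
    nlinarith [sq_nonneg u]
  refine absurd (hmin (p, x) ⟨⟨hp, hx⟩, ⟨q, hq, hcq⟩, w, hws, fun z hz => ?_⟩) hlt.not_ge
  rw [← axisPoint_dist_le_iff, ← hw, axisPoint_dist_le_iff]
  exact hemp z hz

theorem collinear_of_cross_eq_zero {p q r : ℂ} (h : cross p q r = 0) :
    Collinear ℝ {p, q, r} := by
  by_cases hpq : p = q
  · subst hpq
    simpa using collinear_pair ℝ p r
  have hn := sq_dist_pos hpq
  rw [cross] at h
  rw [collinear_iff_of_mem (p₀ := p) (by simp)]
  refine ⟨q - p, ?_⟩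
  simp only [Set.mem_insert_iff, Set.mem_singleton_iff, forall_eq_or_imp, forall_eq]
  refine ⟨⟨0, by simp⟩, ⟨1, by simp⟩,
    ((r.re - p.re) * (q.re - p.re) + (r.im - p.im) * (q.im - p.im)) /
      ((p.re - q.re) ^ 2 + (p.im - q.im) ^ 2), Complex.ext ?_ ?_⟩
  · simp only [vadd_eq_add, Complex.add_re, Complex.smul_re, Complex.sub_re, smul_eq_mul]
    field_simp
    linear_combination (-(q.im - p.im)) * h
  · simp only [vadd_eq_add, Complex.add_im, Complex.smul_im, Complex.sub_im, smul_eq_mul]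
    field_simp
    linear_combination (q.re - p.re) * h

/-- If there are no loose pairs, then an empty circle through three non-collinear vertices is not
too large compared to the distance of the first two, if these are closest to each other. -/
theorem radius_le_of_no_loose {β : ℝ} (hβ : 1 / 2 < β) {P : Finset ℂ}
    (hP : ∀ x ∈ P, x ∈ square) (hno : ∀ p q : ℂ, ¬ Loose β P p q) {p q r o : ℂ} (hp : p ∈ P)
    (hq : q ∈ P) (hr : r ∈ P) (hc : cross p q r ≠ 0) (hle : dist p q ≤ dist r p)
    (h1 : dist o p = dist o q) (h2 : dist o r = dist o p) (he : ∀ x ∈ P, dist o p ≤ dist o x) :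
    dist o p ≤ β * dist p q := by
  -- Reversing the orientation swaps `p` and `q`. If the other side `rq` is then shorter than `pq`,
  -- the bound is proved for `rq`, which is stronger.
  wlog hpos : 0 < cross p q r generalizing p q r o with H
  · have hs : cross q p r = - cross p q r := by simp only [cross]; ring
    by_cases hle2 : dist q p ≤ dist r q
    · rw [h1, dist_comm p q]
      refine H hq hp hr ?_ hle2 h1.symm (h2.trans h1) (fun x hx => h1 ▸ he x hx) ?_
      · rw [hs, neg_ne_zero]; exact hc
      · rw [hs, neg_pos]; exact lt_of_le_of_ne (not_lt.1 hpos) hc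
    · have hs : cross r q p = - cross p q r := by simp only [cross]; ring
      have := H hr hq hp (by rw [hs, neg_ne_zero]; exact hc)
        (by rw [dist_comm p r]; linarith [dist_comm p q])
        (h2.trans h1) h2.symm (fun x hx => h2 ▸ he x hx)
        (by rw [hs, neg_pos]; exact lt_of_le_of_ne (not_lt.1 hpos) hc)
      rw [h2] at this
      refine this.trans ?_
      gcongr
      linarith [dist_comm p q]
  have h0 := leafHeight_pos hβ
  by_contra! hR
  have hpq : p ≠ q := by
    rintro rfl
    rw [cross] at hpos
    linarith
  have hrq : r ≠ q := by
    rintro rfl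
    rw [cross_right] at hpos
    exact lt_irrefl _ hpos
  obtain ⟨t, rfl⟩ := exists_eq_axisPoint hpq h1
  have hd := pow_pos (dist_pos.2 hrq) 2
  have hsum := dist_sq_add_dist_sq p q r
  have hle' : dist p q ^ 2 ≤ dist r p ^ 2 := by gcongr
  have htr : diamPower p q r = 2 * t * cross p q r :=
    le_antisymm ((axisPoint_le_dist_iff t p q r).1 h2.le) ((axisPoint_dist_le_iff t p q r).1 h2.ge)
  -- The angle at `r` is acute because `pq` is not longer than `rp`. Positivity of `t` is needed to
  -- compare heights by their squares.
  have ht0 : 0 < t := by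
    by_contra! h
    nlinarith
  refine not_empty_beyond_leaf hβ hP hno hp hq hr hpos (t := t) ?_
    fun x hx => (axisPoint_dist_le_iff t p q x).1 (he x hx)
  have hp2 := pow_pos (dist_pos.2 hpq) 2
  have h3 : (β * dist p q) ^ 2 < dist (axisPoint t p q) p ^ 2 := by
    have : 0 ≤ β * dist p q := mul_nonneg (by linarith) dist_nonneg
    gcongr
  rw [axisPoint_dist_left_sq, mul_pow] at h3
  have h4 := lt_of_mul_lt_mul_right h3 hp2.le
  have h5 := leafHeight_sq hβ
  by_contra! h
  nlinarith

theorem not_isBadTriangle_of_no_loose {β : ℝ} (hβ : 1 / 2 < β) {P : Finset ℂ}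
    (hP : ∀ x ∈ P, x ∈ square) (hno : ∀ p q : ℂ, ¬ Loose β P p q) {p q r : ℂ}
    (hD : IsDelaunayTriangle P p q r) : ¬ IsBadTriangle β p q r := by
  rintro ⟨o', R', ⟨h1', h2', h3'⟩, hbad⟩
  obtain ⟨hp, hq, hr, hcol, o, R, ⟨h1, h2, h3⟩, he⟩ := hD
  have hc : cross p q r ≠ 0 := fun h => hcol (collinear_of_cross_eq_zero h)
  have hpq : p ≠ q := by
    rintro rfl
    apply hc
    rw [cross]; ring
  have hqr : q ≠ r := by
    rintro rfl
    exact hc (cross_right _ _)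
  have hrp : r ≠ p := by
    rintro rfl
    exact hc (cross_left _ _)
  have hoo : o' = o := by
    obtain ⟨t, rfl⟩ := exists_eq_axisPoint hpq (h1.trans h2.symm)
    obtain ⟨t', rfl⟩ := exists_eq_axisPoint hpq (h1'.trans h2'.symm)
    have e1 : diamPower p q r = 2 * t * cross p q r :=
      le_antisymm ((axisPoint_le_dist_iff t p q r).1 (h3.trans h1.symm).le)
        ((axisPoint_dist_le_iff t p q r).1 (h1.trans h3.symm).le)
    have e2 : diamPower p q r = 2 * t' * cross p q r :=
      le_antisymm ((axisPoint_le_dist_iff t' p q r).1 (h3'.trans h1'.symm).le)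
        ((axisPoint_dist_le_iff t' p q r).1 (h1'.trans h3'.symm).le)
    have e3 : t' = t := by
      have := mul_right_cancel₀ hc (e1.symm.trans e2)
      linarith
    rw [e3]
  rw [hoo] at h1'
  have hRR : R' = R := h1'.symm.trans h1
  subst hRR
  have hcyc : cross q r p = cross p q r := by simp only [cross]; ring
  have hcyc2 : cross r p q = cross p q r := by simp only [cross]; ring
  have hmpos : 0 < min (dist p q) (min (dist q r) (dist r p)) :=
    lt_min (dist_pos.2 hpq) (lt_min (dist_pos.2 hqr) (dist_pos.2 hrp))
  rw [lt_div_iff₀ hmpos] at hbad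
  rcases le_total (dist p q) (min (dist q r) (dist r p)) with h | h
  · rw [min_eq_left h] at hbad
    have := radius_le_of_no_loose hβ hP hno hp hq hr hc (h.trans (min_le_right _ _))
      (h1.trans h2.symm) (h3.trans h1.symm) (fun x hx => h1.trans_le (he x hx))
    linarith
  rw [min_eq_right h] at hbad
  rcases le_total (dist q r) (dist r p) with h' | h'
  · rw [min_eq_left h'] at hbad h
    have := radius_le_of_no_loose hβ hP hno hq hr hp (hcyc ▸ hc) h
      (h2.trans h3.symm) (h1.trans h2.symm) (fun x hx => h2.trans_le (he x hx))
    linarith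
  · rw [min_eq_right h'] at hbad
    have := radius_le_of_no_loose hβ hP hno hr hp hq (hcyc2 ▸ hc) h'
      (h3.trans h1.symm) (h2.trans h3.symm) (fun x hx => h3.trans_le (he x hx))
    linarith

/-! ### The boundary of the square -/

/-- The rotation of the unit square by a right angle. -/
def rot (z : ℂ) : ℂ := Complex.I * z + 1

theorem rot_re (z : ℂ) : (rot z).re = 1 - z.im := by simp [rot]; ring

theorem rot_im (z : ℂ) : (rot z).im = z.re := by simp [rot]

theorem rot_injective : Function.Injective rot := fun a b h => by
  simpa [rot] using h

theorem dist_rot (a b : ℂ) : dist (rot a) (rot b) = dist a b := by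
  rw [← sq_eq_sq₀ dist_nonneg dist_nonneg, dist_sq_eq, dist_sq_eq, rot_re, rot_im, rot_re, rot_im]
  ring

theorem rot_mem_square_iff (z : ℂ) : rot z ∈ square ↔ z ∈ square := by
  simp only [square, Set.mem_ofPred_eq, rot_re, rot_im]
  constructor
  · rintro ⟨h1, h2, h3, h4⟩
    refine ⟨?_, ?_, ?_, ?_⟩ <;> linarith
  · rintro ⟨h1, h2, h3, h4⟩
    refine ⟨?_, ?_, ?_, ?_⟩ <;> linarith

theorem rot_mem_squareBoundary_iff (z : ℂ) :
    rot z ∈ squareBoundary ↔ z ∈ squareBoundary := by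
  simp only [squareBoundary, Set.mem_ofPred_eq, rot_mem_square_iff, rot_re, rot_im]
  have h1 : 1 - z.im = 0 ↔ z.im = 1 := ⟨fun h => by linarith, fun h => by linarith⟩
  have h2 : 1 - z.im = 1 ↔ z.im = 0 := ⟨fun h => by linarith, fun h => by linarith⟩
  rw [h1, h2]
  tauto

theorem rot_surjective : Function.Surjective rot := fun z =>
  ⟨-Complex.I * (z - 1), by
    rw [rot]
    linear_combination (1 - z) * Complex.I_mul_I⟩

theorem cross_rot (p q x : ℂ) : cross (rot p) (rot q) (rot x) = cross p q x := by
  simp only [cross, rot_re, rot_im]; ring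

theorem rot_mem_segment_iff (e f x : ℂ) :
    rot x ∈ segment ℝ (rot e) (rot f) ↔ x ∈ segment ℝ e f := by
  constructor
  · rintro ⟨a, b, ha, hb, hab, h⟩
    refine ⟨a, b, ha, hb, hab, rot_injective ?_⟩
    rw [← h]
    have : (a : ℂ) + b = 1 := by exact_mod_cast hab
    simp only [rot, Complex.real_smul]
    linear_combination (-1 : ℂ) * this
  · rintro ⟨a, b, ha, hb, hab, h⟩
    refine ⟨a, b, ha, hb, hab, ?_⟩
    rw [← h]
    have : (a : ℂ) + b = 1 := by exact_mod_cast hab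
    simp only [rot, Complex.real_smul]
    linear_combination this

theorem isBoundarySegment_image_rot_iff (P : Finset ℂ) (e f : ℂ) :
    IsBoundarySegment (P.image rot) (rot e) (rot f) ↔ IsBoundarySegment P e f := by
  classical
  have hm : ∀ z, rot z ∈ P.image rot ↔ z ∈ P := fun z => by
    simp [rot_injective.eq_iff]
  refine and_congr (hm e) (and_congr (hm f) (and_congr rot_injective.ne_iff (and_congr ?_ ?_)))
  · rw [Set.subset_def, rot_surjective.forall]
    simp only [rot_mem_segment_iff, rot_mem_squareBoundary_iff, Set.subset_def]
  · rw [rot_surjective.forall]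
    simp only [hm, rot_mem_segment_iff, rot_injective.eq_iff]

theorem rot_mid (e f : ℂ) : rot ((e + f) / 2) = (rot e + rot f) / 2 := by
  simp only [rot]; ring

theorem encroaches_rot_iff (r e f : ℂ) :
    Encroaches (rot r) (rot e) (rot f) ↔ Encroaches r e f := by
  rw [Encroaches, Encroaches, ← rot_mid, dist_rot, dist_rot]

theorem encroaches_iff (r e f : ℂ) : Encroaches r e f ↔ diamPower e f r < 0 := by
  rw [Encroaches, lt_div_iff₀ two_pos, ← sq_lt_sq₀ (by positivity) dist_nonneg, mul_pow,
    dist_sq_eq, dist_sq_eq, diamPower]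
  have h1 : ((e + f) / 2).re = (e.re + f.re) / 2 := by simp
  have h2 : ((e + f) / 2).im = (e.im + f.im) / 2 := by simp
  rw [h1, h2]
  constructor <;> intro h <;> nlinarith

/-- A set of vertices in the square that contains the corners, such that no vertex encroaches a
boundary segment. -/
structure Unencroached (P : Finset ℂ) : Prop where
  mem_square : ∀ x ∈ P, x ∈ square
  corner : ∀ x : ℂ, (x.re = 0 ∨ x.re = 1) → (x.im = 0 ∨ x.im = 1) → x ∈ P
  not_encroaches : ∀ x ∈ P, ∀ e f, IsBoundarySegment P e f → ¬ Encroaches x e f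

theorem Unencroached.image_rot {P : Finset ℂ} (h : Unencroached P) :
    Unencroached (P.image rot) where
  mem_square := by
    simp only [Finset.forall_mem_image, rot_mem_square_iff]
    exact h.mem_square
  corner := by
    rw [rot_surjective.forall]
    intro x h1 h2
    refine Finset.mem_image_of_mem _ (h.corner x ?_ ?_)
    · rwa [rot_im] at h2
    · rw [rot_re] at h1
      rcases h1 with h1 | h1
      · right; linarith
      · left; linarith
  not_encroaches := Finset.forall_mem_image.2 fun x hx =>
    rot_surjective.forall.2 fun e => rot_surjective.forall.2 fun f => by
      rw [isBoundarySegment_image_rot_iff, encroaches_rot_iff]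
      exact h.not_encroaches x hx e f

theorem re_mem_Icc_of_mem_segment_bottom {e f x : ℂ} (he : e.im = 0) (hf : f.im = 0)
    (h : e.re ≤ f.re) (hx : x ∈ segment ℝ e f) : x.im = 0 ∧ e.re ≤ x.re ∧ x.re ≤ f.re := by
  obtain ⟨a, b, ha, hb, hab, rfl⟩ := hx
  have : a = 1 - b := by linarith
  subst this
  simp only [Complex.add_re, Complex.add_im, Complex.smul_re, Complex.smul_im, smul_eq_mul, he, hf]
  refine ⟨by ring, by nlinarith, by nlinarith⟩

/-- An empty circle through two vertices whose centre is on or below the bottom edge. -/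
theorem Unencroached.bottom {P : Finset ℂ} (h : Unencroached P) {p q r : ℂ} (hp : p ∈ P)
    (hq : q ∈ P) (hpq : p ≠ q) (hsq : ∃ x ∈ square, 0 < cross p q x) (hr : 0 < cross p q r)
    (hd : dist r p = dist r q) (he : ∀ x ∈ P, dist r p ≤ dist r x) (him : r.im ≤ 0) :
    ∃ e f, IsBoundarySegment P e f ∧ Encroaches r e f := by
  classical
  -- Coordinate form of: a vertex `v` on the bottom edge is not closer to `r` than a vertex `w` on
  -- the circle.
  have key : ∀ v ∈ P, v.im = 0 → ∀ w ∈ P, dist r w = dist r p →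
      (w.re - v.re) * (w.re + v.re - 2 * r.re) + w.im * (w.im - 2 * r.im) ≤ 0 := by
    intro v hv hv0 w hw hwr
    have h1 := he v hv
    rw [← hwr, dist_le_dist_iff, hv0] at h1
    nlinarith
  have hp4 := h.mem_square p hp
  have hq4 := h.mem_square q hq
  simp only [square, Set.mem_ofPred_eq] at hp4 hq4
  obtain ⟨hp1, hp2, hp3, hp4⟩ := hp4
  obtain ⟨hq1, hq2, hq3, hq4⟩ := hq4
  have c0 : (⟨0, 0⟩ : ℂ) ∈ P := h.corner _ (Or.inl rfl) (Or.inl rfl)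
  have c1 : (⟨1, 0⟩ : ℂ) ∈ P := h.corner _ (Or.inr rfl) (Or.inl rfl)
  -- no vertex of the edge is nearest to `r` within the square
  have near : ∀ v ∈ P, v.im = 0 →
      ¬ ∀ w ∈ P, 0 ≤ (w.re - v.re) * (w.re + v.re - 2 * r.re) ∧
        ((w.re - v.re) * (w.re + v.re - 2 * r.re) = 0 → w.re = v.re) := by
    intro v hv hv0 hcon
    have : ∀ w ∈ P, dist r w = dist r p → w = v := by
      intro w hw hwr
      have h1 := key v hv hv0 w hw hwr
      obtain ⟨h2, h3⟩ := hcon w hw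
      have hwim : 0 ≤ w.im := (h.mem_square w hw).2.2.1
      have h4 : 0 ≤ w.im * (w.im - 2 * r.im) := by nlinarith
      refine Complex.ext (h3 (by linarith)) ?_
      rw [hv0]
      nlinarith
    exact hpq ((this p hp rfl).trans (this q hq hd.symm).symm)
  have hr0 : 0 < r.re := by
    by_contra! hcon
    refine near _ c0 rfl fun w hw => ?_
    have hw0 : 0 ≤ w.re := (h.mem_square w hw).1
    dsimp only
    exact ⟨by nlinarith, fun h => by nlinarith⟩
  have hr1 : r.re < 1 := by
    by_contra! hcon
    refine near _ c1 rfl fun w hw => ?_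
    have hw0 : w.re ≤ 1 := (h.mem_square w hw).2.1
    dsimp only
    exact ⟨by nlinarith, fun h => by nlinarith⟩
  have hne : ∀ v ∈ P, v.im = 0 → v.re ≠ r.re := by
    intro v hv hv0 hvr
    refine near v hv hv0 fun w hw => ?_
    rw [← hvr]
    have : (w.re - v.re) * (w.re + v.re - 2 * v.re) = (w.re - v.re) ^ 2 := by ring
    rw [this]
    exact ⟨sq_nonneg _, fun h => by
      have := pow_eq_zero_iff (two_ne_zero) |>.1 h
      linarith⟩
  obtain ⟨e, hem, hemax⟩ := Finset.exists_max_image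
    (P.filter fun v => v.im = 0 ∧ v.re < r.re) Complex.re
    ⟨_, Finset.mem_filter.2 ⟨c0, rfl, hr0⟩⟩
  obtain ⟨f, hfm, hfmin⟩ := Finset.exists_min_image
    (P.filter fun v => v.im = 0 ∧ r.re < v.re) Complex.re
    ⟨_, Finset.mem_filter.2 ⟨c1, rfl, hr1⟩⟩
  obtain ⟨heP, he0, her⟩ := Finset.mem_filter.1 hem
  obtain ⟨hfP, hf0, hfr⟩ := Finset.mem_filter.1 hfm
  have he1 : 0 ≤ e.re := (h.mem_square e heP).1
  have hf1 : f.re ≤ 1 := (h.mem_square f hfP).2.1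
  have hcons : ∀ x ∈ P, x.im = 0 → e.re ≤ x.re → x.re ≤ f.re → x = e ∨ x = f := by
    intro x hx hx0 h1 h2
    rcases lt_or_gt_of_ne (hne x hx hx0) with h3 | h3
    · left
      exact Complex.ext (le_antisymm (hemax x (Finset.mem_filter.2 ⟨hx, hx0, h3⟩)) h1)
        (hx0.trans he0.symm)
    · right
      exact Complex.ext (le_antisymm h2 (hfmin x (Finset.mem_filter.2 ⟨hx, hx0, h3⟩)))
        (hx0.trans hf0.symm)
  have hseg : IsBoundarySegment P e f := by
    refine ⟨heP, hfP, fun hef => ?_, fun x hx => ?_, fun x hx hxs => ?_⟩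
    · rw [hef] at her; linarith
    · obtain ⟨h1, h2, h3⟩ := re_mem_Icc_of_mem_segment_bottom he0 hf0 (by linarith) hx
      refine ⟨⟨by linarith, by linarith, by linarith, by linarith⟩, Or.inr (Or.inr (Or.inl h1))⟩
    · obtain ⟨h1, h2, h3⟩ := re_mem_Icc_of_mem_segment_bottom he0 hf0 (by linarith) hxs
      exact hcons x hx h1 h2 h3
  refine ⟨e, f, hseg, ?_⟩
  rcases him.eq_or_lt with him | him
  · rw [encroaches_iff, diamPower, him, he0]
    nlinarith
  exfalso
  -- With the centre below the edge, the part of the disk above the edge lies within the diametral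
  -- disk of `ef`. Vertices do not encroach, so those on the circle can only be `e` and `f`.
  have hend : ∀ w ∈ P, dist r w = dist r p → w = e ∨ w = f := by
    intro w hw hwr
    have k1 := key e heP he0 w hw hwr
    have k2 := key f hfP hf0 w hw hwr
    have hwim : 0 ≤ w.im := (h.mem_square w hw).2.2.1
    have h4 : 0 ≤ w.im * (w.im - 2 * r.im) := by nlinarith
    have g := h.not_encroaches w hw e f hseg
    rw [encroaches_iff, not_lt, diamPower, he0, hf0] at g
    have hwf : w.re ≤ f.re := by
      by_contra! hcon
      nlinarith
    have hwe : e.re ≤ w.re := by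
      by_contra! hcon
      nlinarith
    have h0 : w.im = 0 := by
      -- The endpoint nearer to `r` is used: its distance inequality combined with non-encroachment
      -- forces `w.im = 0`.
      rcases le_total (e.re + f.re) (2 * r.re) with hm | hm <;> nlinarith
    exact hcons w hw h0 hwe hwf
  -- Now `pq` is the segment `ef` in one of its two directions. In one, `r` is not to the left; in
  -- the other, no point of the square is, so that leaf does not count.
  obtain ⟨x, hx, hxc⟩ := hsq
  have hx3 : 0 ≤ x.im := hx.2.2.1
  rw [cross] at hr hxc
  rcases hend p hp rfl with rfl | rfl <;> rcases hend q hq hd.symm with rfl | rfl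
  · exact hpq rfl
  · rw [he0, hf0] at hr
    nlinarith
  · rw [he0, hf0] at hxc
    nlinarith
  · exact hpq rfl

/-- The centre of an empty circle through two vertices lies inside the square, unless it
encroaches a boundary segment. -/
theorem Unencroached.mem_interior {P : Finset ℂ} (h : Unencroached P) {p q r : ℂ} (hp : p ∈ P)
    (hq : q ∈ P) (hpq : p ≠ q) (hsq : ∃ x ∈ square, 0 < cross p q x) (hr : 0 < cross p q r)
    (hd : dist r p = dist r q) (he : ∀ x ∈ P, dist r p ≤ dist r x)
    (hfree : ∀ e f, IsBoundarySegment P e f → ¬ Encroaches r e f) :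
    r ∈ square ∧ r ∉ squareBoundary := by
  classical
  -- The heights of the first four rotated copies of `r` are its signed distances from the four
  -- edges, so the bottom edge suffices.
  suffices H : ∀ n : ℕ, 0 < (rot^[n] r).im by
    have h0 := H 0
    have h1 := H 1
    have h2 := H 2
    have h3 := H 3
    simp only [Function.iterate_succ, Function.iterate_zero, Function.comp_apply, id, rot_im,
      rot_re] at h0 h1 h2 h3
    refine ⟨⟨h1.le, by linarith, h0.le, by linarith⟩, ?_⟩
    rintro ⟨-, h4 | h4 | h4 | h4⟩ <;> linarith
  intro n
  induction n generalizing P p q r with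
  | zero =>
    by_contra! hcon
    obtain ⟨e, f, h1, h2⟩ := h.bottom hp hq hpq hsq hr hd he hcon
    exact hfree e f h1 h2
  | succ n ih =>
    rw [Function.iterate_succ_apply]
    refine ih h.image_rot (Finset.mem_image_of_mem _ hp) (Finset.mem_image_of_mem _ hq)
      (rot_injective.ne hpq) ?_ (by rwa [cross_rot]) (by rwa [dist_rot, dist_rot]) ?_ ?_
    · obtain ⟨x, hx, hxc⟩ := hsq
      exact ⟨rot x, (rot_mem_square_iff x).2 hx, by rwa [cross_rot]⟩
    · simpa only [Finset.forall_mem_image, dist_rot] using he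
    · refine rot_surjective.forall.2 fun e => rot_surjective.forall.2 fun f => ?_
      rw [isBoundarySegment_image_rot_iff, encroaches_rot_iff]
      exact hfree e f

/-! ### Insertion of vertices -/

theorem add_div_two_mem_segment (e f : ℂ) : (e + f) / 2 ∈ segment ℝ e f :=
  ⟨1 / 2, 1 / 2, by norm_num, by norm_num, by norm_num, by
    simp only [Complex.real_smul]; push_cast; ring⟩

/-- Each edge is the face of the square on which a coordinate is extremal, so a midpoint lies on it
only if both endpoints do. -/
theorem same_edge {e f : ℂ} (he : e ∈ square) (hf : f ∈ square)
    (h : (e + f) / 2 ∈ squareBoundary) : (e.re = f.re ∧ (e.re = 0 ∨ e.re = 1)) ∨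
      (e.im = f.im ∧ (e.im = 0 ∨ e.im = 1)) := by
  have h1 : ((e + f) / 2).re = (e.re + f.re) / 2 := by simp
  have h2 : ((e + f) / 2).im = (e.im + f.im) / 2 := by simp
  simp only [squareBoundary, square, Set.mem_ofPred_eq, h1, h2] at he hf h
  obtain ⟨a1, a2, a3, a4⟩ := he
  obtain ⟨b1, b2, b3, b4⟩ := hf
  rcases h.2 with h | h | h | h
  · exact Or.inl ⟨by linarith, Or.inl (by linarith)⟩
  · exact Or.inl ⟨by linarith, Or.inr (by linarith)⟩
  · exact Or.inr ⟨by linarith, Or.inl (by linarith)⟩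
  · exact Or.inr ⟨by linarith, Or.inr (by linarith)⟩

theorem IsBoundarySegment.symm {P : Finset ℂ} {e f : ℂ} (h : IsBoundarySegment P e f) :
    IsBoundarySegment P f e := by
  obtain ⟨h1, h2, h3, h4, h5⟩ := h
  rw [segment_symm] at h4 h5
  exact ⟨h2, h1, h3.symm, h4, fun x hx hxs => (h5 x hx hxs).symm⟩

theorem Encroaches.symm {x e f : ℂ} (h : Encroaches x e f) : Encroaches x f e := by
  rwa [Encroaches, add_comm, dist_comm f e]

/-- A point of the boundary inside the diametral circle of a segment on an edge of the square
lies on the segment. -/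
theorem mem_segment_of_encroaches {e f x : ℂ} (he : e ∈ square) (hf : f ∈ square)
    (h : (e + f) / 2 ∈ squareBoundary) (hx : x ∈ squareBoundary) (hxe : Encroaches x e f) :
    x ∈ segment ℝ e f := by
  rw [encroaches_iff, diamPower] at hxe
  have hs := same_edge he hf h
  obtain ⟨⟨c1, c2, c3, c4⟩, hx⟩ := hx
  obtain ⟨a1, a2, a3, a4⟩ := he
  obtain ⟨b1, b2, b3, b4⟩ := hf
  rcases hs with ⟨h1, h2⟩ | ⟨h1, h2⟩
  · have hne : e.im ≠ f.im := by
      intro h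
      rw [← h1, ← h] at hxe
      nlinarith [sq_nonneg (x.re - e.re), sq_nonneg (x.im - e.im)]
    have hre : x.re = e.re := by
      rw [← h1] at hxe
      rcases hx with hx | hx | hx | hx <;> rcases h2 with h2 | h2 <;> nlinarith
    rw [← h1, hre] at hxe
    refine ⟨(f.im - x.im) / (f.im - e.im), (x.im - e.im) / (f.im - e.im), ?_, ?_, ?_, ?_⟩
    · rcases lt_or_gt_of_ne hne with h | h
      · exact div_nonneg (by nlinarith) (by linarith)
      · exact div_nonneg_of_nonpos (by nlinarith) (by linarith)
    · rcases lt_or_gt_of_ne hne with h | h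
      · exact div_nonneg (by nlinarith) (by linarith)
      · exact div_nonneg_of_nonpos (by nlinarith) (by linarith)
    · have := sub_ne_zero.2 hne.symm
      field_simp
      ring
    · have := sub_ne_zero.2 hne.symm
      refine Complex.ext ?_ ?_
      · simp only [Complex.add_re, Complex.smul_re, smul_eq_mul, ← h1, hre]
        field_simp
        ring
      · simp only [Complex.add_im, Complex.smul_im, smul_eq_mul]
        field_simp
        ring
  · have hne : e.re ≠ f.re := by
      intro h
      rw [← h1, ← h] at hxe
      nlinarith [sq_nonneg (x.re - e.re), sq_nonneg (x.im - e.im)]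
    have him : x.im = e.im := by
      rw [← h1] at hxe
      rcases hx with hx | hx | hx | hx <;> rcases h2 with h2 | h2 <;> nlinarith
    rw [← h1, him] at hxe
    refine ⟨(f.re - x.re) / (f.re - e.re), (x.re - e.re) / (f.re - e.re), ?_, ?_, ?_, ?_⟩
    · rcases lt_or_gt_of_ne hne with h | h
      · exact div_nonneg (by nlinarith) (by linarith)
      · exact div_nonneg_of_nonpos (by nlinarith) (by linarith)
    · rcases lt_or_gt_of_ne hne with h | h
      · exact div_nonneg (by nlinarith) (by linarith)
      · exact div_nonneg_of_nonpos (by nlinarith) (by linarith)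
    · have := sub_ne_zero.2 hne.symm
      field_simp
      ring
    · have := sub_ne_zero.2 hne.symm
      refine Complex.ext ?_ ?_
      · simp only [Complex.add_re, Complex.smul_re, smul_eq_mul]
        field_simp
        ring
      · simp only [Complex.add_im, Complex.smul_im, smul_eq_mul, ← h1, him]
        field_simp
        ring

theorem not_encroaches_left (e f : ℂ) : ¬ Encroaches e e f := by
  rw [encroaches_iff, diamPower_left]
  exact lt_irrefl 0

theorem not_encroaches_right (e f : ℂ) : ¬ Encroaches f e f := by
  rw [encroaches_iff, diamPower_right]
  exact lt_irrefl 0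

/-- A vertex on the boundary encroaches no boundary segment. -/
theorem IsBoundarySegment.not_encroaches {P : Finset ℂ} (hP : ∀ x ∈ P, x ∈ square) {e f x : ℂ}
    (h : IsBoundarySegment P e f) (hx : x ∈ P) (hxb : x ∈ squareBoundary) :
    ¬ Encroaches x e f := by
  intro hxe
  have := mem_segment_of_encroaches (hP e h.1) (hP f h.2.1)
    (h.2.2.2.1 (add_div_two_mem_segment e f)) hxb hxe
  rcases h.2.2.2.2 x hx this with rfl | rfl
  exacts [not_encroaches_left _ _ hxe, not_encroaches_right _ _ hxe]

/-- An interior vertex is no endpoint of a boundary segment, so it creates no new ones. -/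
theorem Unencroached.insert {P : Finset ℂ} (h : Unencroached P) {r : ℂ} (hr : r ∈ square)
    (hrb : r ∉ squareBoundary)
    (hfree : ∀ e f, IsBoundarySegment P e f → ¬ Encroaches r e f) :
    Unencroached (Insert.insert r P) where
  mem_square x hx := by
    rcases Finset.mem_insert.1 hx with rfl | hx
    exacts [hr, h.mem_square x hx]
  corner x h1 h2 := Finset.mem_insert_of_mem (h.corner x h1 h2)
  not_encroaches x hx e f hef := by
    obtain ⟨h1, h2, h3, h4, h5⟩ := hef
    have hef : IsBoundarySegment P e f := by
      refine ⟨?_, ?_, h3, h4, fun x hx => h5 x (Finset.mem_insert_of_mem hx)⟩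
      · rcases Finset.mem_insert.1 h1 with rfl | h1
        exacts [(hrb (h4 (left_mem_segment ℝ _ _))).elim, h1]
      · rcases Finset.mem_insert.1 h2 with rfl | h2
        exacts [(hrb (h4 (right_mem_segment ℝ _ _))).elim, h2]
    rcases Finset.mem_insert.1 hx with rfl | hx
    exacts [hfree e f hef, h.not_encroaches x hx e f hef]

/-- The segments created by splitting a segment are its halves. -/
theorem IsBoundarySegment.eq_of_midpoint {P : Finset ℂ} (hP : ∀ x ∈ P, x ∈ square) {e f g : ℂ}
    (h : IsBoundarySegment P e f)
    (hg : IsBoundarySegment (Insert.insert ((e + f) / 2) P) ((e + f) / 2) g) :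
    g = e ∨ g = f := by
  obtain ⟨heP, hfP, hef, hsub, hcons⟩ := h
  obtain ⟨-, hgP, hmg, hsub', hcons'⟩ := hg
  replace hgP : g ∈ P := (Finset.mem_insert.1 hgP).resolve_left hmg.symm
  have hmS := hsub (add_div_two_mem_segment e f)
  have h1 := same_edge (hP e heP) (hP f hfP) hmS
  have h2 := same_edge hmS.1 (hP g hgP) (hsub' (add_div_two_mem_segment _ _))
  have m1 : ((e + f) / 2).re = (e.re + f.re) / 2 := by simp
  have m2 : ((e + f) / 2).im = (e.im + f.im) / 2 := by simp
  rw [m1, m2] at h2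
  have hE := hP e heP
  have hF := hP f hfP
  obtain ⟨a1, a2, a3, a4⟩ := hE
  obtain ⟨b1, b2, b3, b4⟩ := hF
  -- The point `g` is on the line `ef`. For `|c| ≤ 1 / 2` it is on the segment; otherwise `e` or `f`
  -- is between the midpoint and `g`.
  have hlam : ∃ c : ℝ, g = (e + f) / 2 + (c : ℂ) * (f - e) := by
    by_cases hre : e.re = f.re
    · have him : e.im ≠ f.im := fun h => hef (Complex.ext hre h)
      have hgre : g.re = e.re := by
        rcases h2 with ⟨h2, -⟩ | ⟨-, h2⟩
        · linarith
        · exfalso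
          rcases h2 with h2 | h2 <;> exact him (by linarith)
      have := sub_ne_zero.2 him.symm
      refine ⟨(g.im - (e.im + f.im) / 2) / (f.im - e.im), Complex.ext ?_ ?_⟩
      · rw [Complex.add_re, m1, Complex.re_ofReal_mul, Complex.sub_re, hgre, hre]; ring
      · rw [Complex.add_im, m2, Complex.im_ofReal_mul, Complex.sub_im]
        field_simp
        ring
    · have him : e.im = f.im := by
        rcases h1 with ⟨h1, -⟩ | ⟨h1, -⟩
        exacts [(hre h1).elim, h1]
      have hgim : g.im = e.im := by
        rcases h2 with ⟨-, h2⟩ | ⟨h2, -⟩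
        · exfalso
          rcases h2 with h2 | h2 <;> exact hre (by linarith)
        · linarith
      have := sub_ne_zero.2 (Ne.symm hre)
      refine ⟨(g.re - (e.re + f.re) / 2) / (f.re - e.re), Complex.ext ?_ ?_⟩
      · rw [Complex.add_re, m1, Complex.re_ofReal_mul, Complex.sub_re]
        field_simp
        ring
      · rw [Complex.add_im, m2, Complex.im_ofReal_mul, Complex.sub_im, hgim, him]; ring
  obtain ⟨c, hc⟩ := hlam
  by_cases hc1 : |c| ≤ 1 / 2
  · rw [abs_le] at hc1
    refine hcons g hgP ⟨1 / 2 - c, 1 / 2 + c, by linarith, by linarith, by ring, ?_⟩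
    rw [hc]
    simp only [Complex.real_smul]
    push_cast
    ring
  push Not at hc1
  have hmm : ∀ x ∈ P, x ∈ segment ℝ ((e + f) / 2) g → x = (e + f) / 2 ∨ x = g :=
    fun x hx => hcons' x (Finset.mem_insert_of_mem hx)
  rcases lt_abs.1 hc1 with hc1 | hc1
  · have hcC : (c : ℂ) ≠ 0 := by
      norm_cast
      linarith
    right
    have hfs : f ∈ segment ℝ ((e + f) / 2) g := by
      refine ⟨1 - 1 / (2 * c), 1 / (2 * c), ?_, by positivity, by ring, ?_⟩
      · rw [sub_nonneg, div_le_one (by linarith)]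
        linarith
      · rw [hc]
        simp only [Complex.real_smul]
        push_cast
        field_simp
        ring
    rcases hmm f hfP hfs with h | h
    · exact (hef (by linear_combination (-2 : ℂ) * h)).elim
    · exact h.symm
  · have hcC : (c : ℂ) ≠ 0 := by
      norm_cast
      linarith
    left
    have hes : e ∈ segment ℝ ((e + f) / 2) g := by
      refine ⟨1 - 1 / (2 * -c), 1 / (2 * -c), ?_, ?_, by ring, ?_⟩
      · rw [sub_nonneg, div_le_one (by linarith)]
        linarith
      · exact div_nonneg zero_le_one (by linarith)
      · rw [hc]
        simp only [Complex.real_smul]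
        push_cast
        field_simp
        ring
    rcases hmm e heP hes with h | h
    · exact (hef (by linear_combination (2 : ℂ) * h)).elim
    · exact h.symm

/-- The diametral disk of one half of a segment is contained in that of the segment. -/
theorem Encroaches.of_half {x e f : ℂ} (h : Encroaches x ((e + f) / 2) e) :
    Encroaches x e f := by
  have m1 : ((e + f) / 2).re = (e.re + f.re) / 2 := by simp
  have m2 : ((e + f) / 2).im = (e.im + f.im) / 2 := by simp
  rw [encroaches_iff, diamPower] at h ⊢
  rw [m1, m2] at h
  nlinarith [sq_nonneg (x.re - e.re), sq_nonneg (x.im - e.im)]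

/-- The new segments are the two halves, whose diametral disks lie in the old one. The midpoint
itself is on the boundary, and vertices there encroach nothing. -/
theorem Unencroached.insert_midpoint {P : Finset ℂ} (h : Unencroached P) {e f : ℂ}
    (hef : IsBoundarySegment P e f) : Unencroached (Insert.insert ((e + f) / 2) P) := by
  have hmb := hef.2.2.2.1 (add_div_two_mem_segment e f)
  have hsq : ∀ x ∈ Insert.insert ((e + f) / 2) P, x ∈ square := by
    intro x hx
    rcases Finset.mem_insert.1 hx with rfl | hx
    exacts [hmb.1, h.mem_square x hx]
  have half : ∀ x ∈ Insert.insert ((e + f) / 2) P, ∀ g,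
      IsBoundarySegment (Insert.insert ((e + f) / 2) P) ((e + f) / 2) g →
        ¬ Encroaches x ((e + f) / 2) g := by
    intro x hx g hg hxe
    rcases Finset.mem_insert.1 hx with rfl | hx'
    · exact not_encroaches_left _ _ hxe
    rcases hef.eq_of_midpoint h.mem_square hg with rfl | rfl
    · exact h.not_encroaches x hx' _ _ hef hxe.of_half
    · rw [add_comm] at hxe
      exact h.not_encroaches x hx' _ _ hef.symm hxe.of_half
  refine ⟨hsq, fun x h1 h2 => Finset.mem_insert_of_mem (h.corner x h1 h2),
    fun x hx a b hab hxe => ?_⟩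
  rcases Finset.mem_insert.1 hab.1 with rfl | ha
  · exact half x hx b hab hxe
  rcases Finset.mem_insert.1 hab.2.1 with rfl | hb
  · exact half x hx a hab.symm hxe.symm
  rcases Finset.mem_insert.1 hx with rfl | hx'
  · exact hab.not_encroaches hsq hx hmb hxe
  · exact h.not_encroaches x hx' a b ⟨ha, hb, hab.2.2.1, hab.2.2.2.1,
      fun y hy => hab.2.2.2.2 y (Finset.mem_insert_of_mem hy)⟩ hxe

/-- If the centre of an empty disk encroaches a segment, then half the length of the segment is
not much smaller than the radius of the disk. -/
theorem Encroaches.radius_le {r e f : ℂ} {R : ℝ} (h : Encroaches r e f) (hR : 0 ≤ R)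
    (he : R ≤ dist r e) (hf : R ≤ dist r f) : R ≤ Real.sqrt 2 * (dist e f / 2) := by
  rw [encroaches_iff] at h
  -- Encroachment makes `diamPower e f r` negative, so `2 * R ^ 2` is less than `dist e f ^ 2`.
  have hs := dist_sq_add_dist_sq e f r
  have h1 : R ^ 2 ≤ dist r e ^ 2 := by gcongr
  have h2 : R ^ 2 ≤ dist r f ^ 2 := by gcongr
  rw [← sq_le_sq₀ hR (by positivity), mul_pow, Real.sq_sqrt zero_le_two]
  nlinarith

/-! ### Cells and quadtrees -/

theorem cellSize_pos (k : ℕ) : 0 < cellSize k := by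
  unfold cellSize; positivity

theorem cellSize_succ (k : ℕ) : cellSize (k + 1) = cellSize k / 2 := by
  unfold cellSize
  rw [pow_succ]
  field_simp

theorem cellSize_zero : cellSize 0 = 1 := by simp [cellSize]

theorem cellSize_anti {j k : ℕ} (h : j ≤ k) : cellSize k ≤ cellSize j := by
  unfold cellSize
  have : (2 : ℝ) ^ j ≤ 2 ^ k := pow_le_pow_right₀ one_le_two h
  exact one_div_le_one_div_of_le (by positivity) this

theorem cellSize_le_one (k : ℕ) : cellSize k ≤ 1 :=
  cellSize_zero ▸ cellSize_anti (Nat.zero_le k)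

theorem cellAt_zero (z : ℂ) : cellAt 0 z = Cell.root := by
  simp [cellAt, Cell.root]

/-- Rounding down and clamping at the far side of the square are both compatible with halving; hence
the cells containing a fixed point are nested. -/
theorem min_floor_succ (k : ℕ) (x : ℝ) : ∃ i < 2, min ⌊(2 : ℝ) ^ (k + 1) * x⌋₊ (2 ^ (k + 1) - 1) =
    2 * min ⌊(2 : ℝ) ^ k * x⌋₊ (2 ^ k - 1) + i := by
  have h : ⌊(2 : ℝ) ^ k * x⌋₊ = ⌊(2 : ℝ) ^ (k + 1) * x⌋₊ / 2 := by
    rw [← Nat.floor_div_ofNat]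
    congr 1
    rw [pow_succ]
    ring
  have h2 : (2 : ℕ) ^ (k + 1) = 2 ^ k * 2 := pow_succ 2 k
  rw [h, h2]
  have := Nat.one_le_two_pow (n := k)
  generalize ⌊(2 : ℝ) ^ (k + 1) * x⌋₊ = a at *
  generalize 2 ^ k = b at *
  exact ⟨min a (b * 2 - 1) - 2 * min (a / 2) (b - 1), by omega, by omega⟩

theorem mem_children_iff (b c : Cell) : c ∈ b.children ↔
    ∃ i < 2, ∃ j < 2, c = ⟨b.depth + 1, 2 * b.col + i, 2 * b.row + j⟩ := by
  simp only [Cell.children, Finset.mem_image, Finset.mem_product, Finset.mem_range, Prod.exists]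
  constructor
  · rintro ⟨i, j, ⟨hi, hj⟩, rfl⟩
    exact ⟨i, hi, j, hj, rfl⟩
  · rintro ⟨i, hi, j, hj, rfl⟩
    exact ⟨i, j, ⟨hi, hj⟩, rfl⟩

theorem cellAt_succ_mem_children (k : ℕ) (z : ℂ) : cellAt (k + 1) z ∈ (cellAt k z).children := by
  obtain ⟨i, hi, hi'⟩ := min_floor_succ k z.re
  obtain ⟨j, hj, hj'⟩ := min_floor_succ k z.im
  rw [mem_children_iff]
  refine ⟨i, hi, j, hj, ?_⟩
  rw [cellAt, hi', hj']
  rfl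

theorem eq_of_mem_children {a b c : Cell} (ha : c ∈ a.children) (hb : c ∈ b.children) : a = b := by
  rw [mem_children_iff] at ha hb
  obtain ⟨i, hi, j, hj, rfl⟩ := ha
  obtain ⟨i', hi', j', hj', h⟩ := hb
  simp only [Cell.mk.injEq] at h
  obtain ⟨h1, h2, h3⟩ := h
  ext <;> omega

theorem depth_of_mem_children {b c : Cell} (h : c ∈ b.children) : c.depth = b.depth + 1 := by
  rw [mem_children_iff] at h
  obtain ⟨i, hi, j, hj, rfl⟩ := h
  rfl

theorem IsQuadtree.cellAt_mem_of_le {T : Finset Cell} (hT : IsQuadtree T) {z : ℂ} {m k : ℕ}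
    (h : m ≤ k) (hk : cellAt k z ∈ T) : cellAt m z ∈ T := by
  induction k, h using Nat.le_induction with
  | base => exact hk
  | succ k _ ih =>
    rcases hT.parent_mem _ hk with h | ⟨b, hb, hc⟩
    · simp [cellAt, Cell.root] at h
    · rw [← eq_of_mem_children hc (cellAt_succ_mem_children k z)] at ih
      exact ih hb

theorem depth_le_treeDepth {T : Finset Cell} {c : Cell} (h : c ∈ T) : c.depth ≤ treeDepth T :=
  Finset.le_sup (f := Cell.depth) h

theorem IsQuadtree.exists_leaf {T : Finset Cell} (hT : IsQuadtree T) (z : ℂ) :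
    ∃ k, IsLeaf T (cellAt k z) := by
  by_contra! hcon
  have h : ∀ k, cellAt k z ∈ T := by
    intro k
    induction k with
    | zero => rw [cellAt_zero]; exact hT.root_mem
    | succ k ih =>
      have h := hcon k
      rw [IsLeaf, not_and] at h
      have h := h ih
      push Not at h
      exact hT.children_subset _ ih h (cellAt_succ_mem_children k z)
  exact absurd (depth_le_treeDepth (h (treeDepth T + 1))) (Nat.not_succ_le_self _)

/-! ### The input -/

theorem mem_boundaryVertices_iff (x : ℂ) : x ∈ boundaryVertices ↔
    ∃ i < 4, ∃ j < 4, (i = 0 ∨ i = 3 ∨ j = 0 ∨ j = 3) ∧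
      (⟨((i : ℕ) : ℝ) / 3, ((j : ℕ) : ℝ) / 3⟩ : ℂ) = x := by
  simp only [boundaryVertices, Finset.mem_image, Finset.mem_filter, Finset.mem_product,
    Finset.mem_range, Prod.exists]
  constructor
  · rintro ⟨i, j, ⟨⟨hi, hj⟩, h⟩, rfl⟩
    exact ⟨i, hi, j, hj, h, rfl⟩
  · rintro ⟨i, hi, j, hj, h, rfl⟩
    exact ⟨i, j, ⟨⟨hi, hj⟩, h⟩, rfl⟩

theorem boundaryVertices_subset {x : ℂ} (hx : x ∈ boundaryVertices) : x ∈ squareBoundary := by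
  obtain ⟨i, hi, j, hj, h, rfl⟩ := (mem_boundaryVertices_iff x).1 hx
  have hi' : (i : ℝ) ≤ 3 := by exact_mod_cast Nat.le_of_lt_succ hi
  have hj' : (j : ℝ) ≤ 3 := by exact_mod_cast Nat.le_of_lt_succ hj
  refine ⟨⟨by positivity, ?_, by positivity, ?_⟩, ?_⟩
  · dsimp only; linarith
  · dsimp only; linarith
  · rcases h with rfl | rfl | rfl | rfl <;> simp

/-- If `x` lies strictly between `a` and `b`, then neither third separates them, so both lie in the
middle third and the product is at least `-1 / 36`. -/
theorem third_mul_add_nonneg {a b x h : ℝ} (hx1 : 1 / 3 ≤ x) (hx2 : x ≤ 2 / 3) (hh : 1 / 9 ≤ h)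
    (h1 : 0 ≤ (1 / 3 - a) * (1 / 3 - b)) (h2 : 0 ≤ (2 / 3 - a) * (2 / 3 - b)) :
    0 ≤ (x - a) * (x - b) + h := by
  wlog hab : a ≤ b generalizing a b
  · have := this (a := b) (b := a) (by linarith) (by linarith) (by linarith)
    linarith
  by_contra! hcon
  have hxa : a < x := by
    by_contra! hc
    nlinarith
  have hxb : x < b := by
    by_contra! hc
    nlinarith
  have ha : 1 / 3 ≤ a := by
    by_contra! hc
    nlinarith
  have hb : b ≤ 2 / 3 := by
    by_contra! hc
    nlinarith
  nlinarith

theorem unencroached_input (Ω : Finset ℂ)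
    (hΩ : ∀ z ∈ Ω, 1 / 3 ≤ z.re ∧ z.re ≤ 2 / 3 ∧ 1 / 3 ≤ z.im ∧ z.im ≤ 2 / 3)
    (T : Finset Cell) : Unencroached (initState Ω T).vertices := by
  classical
  have hmem : ∀ x, x ∈ (initState Ω T).vertices ↔ x ∈ Ω ∨ x ∈ boundaryVertices := fun x => by
    simp [initState]
  have hsq : ∀ x ∈ (initState Ω T).vertices, x ∈ square := by
    intro x hx
    rcases (hmem x).1 hx with hx | hx
    · obtain ⟨h1, h2, h3, h4⟩ := hΩ x hx
      exact ⟨by linarith, by linarith, by linarith, by linarith⟩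
    · exact (boundaryVertices_subset hx).1
  refine ⟨hsq, fun x hre him => (hmem x).2 (Or.inr ?_), fun x hx e f hef hxe => ?_⟩
  · rw [mem_boundaryVertices_iff]
    have aux : ∀ y : ℝ, y = 0 ∨ y = 1 → ∃ i : ℕ, i < 4 ∧ (i = 0 ∨ i = 3) ∧ (i : ℝ) / 3 = y := by
      rintro y (rfl | rfl)
      · exact ⟨0, by norm_num, Or.inl rfl, by norm_num⟩
      · exact ⟨3, by norm_num, Or.inr rfl, by norm_num⟩
    obtain ⟨i, hi, hi', hi2⟩ := aux _ hre
    obtain ⟨j, hj, -, hj2⟩ := aux _ him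
    exact ⟨i, hi, j, hj, by tauto, Complex.ext hi2 hj2⟩
  -- The vertices at the thirds are on the boundary, hence outside every diametral circle. So no
  -- boundary segment extends across a third, while a point of `Ω` is at least `1 / 3` away from
  -- each edge.
  · have hbd : ∀ i < 4, ∀ j < 4, (i = 0 ∨ i = 3 ∨ j = 0 ∨ j = 3) →
        0 ≤ diamPower e f (⟨((i : ℕ) : ℝ) / 3, ((j : ℕ) : ℝ) / 3⟩ : ℂ) := by
      intro i hi j hj h
      have hb := (mem_boundaryVertices_iff _).2 ⟨i, hi, j, hj, h, rfl⟩
      have := hef.not_encroaches hsq ((hmem _).2 (Or.inr hb)) (boundaryVertices_subset hb)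
      rwa [encroaches_iff, not_lt] at this
    rcases (hmem x).1 hx with hx | hx
    · obtain ⟨h1, h2, h3, h4⟩ := hΩ x hx
      rw [encroaches_iff] at hxe
      have hs := same_edge (hsq e hef.1) (hsq f hef.2.1) (hef.2.2.2.1 (add_div_two_mem_segment e f))
      have edge : ∀ c : ℝ, c = 0 ∨ c = 1 → ∃ j : ℕ, j < 4 ∧ (j = 0 ∨ j = 3) ∧ (j : ℝ) / 3 = c := by
        rintro y (rfl | rfl)
        · exact ⟨0, by norm_num, Or.inl rfl, by norm_num⟩
        · exact ⟨3, by norm_num, Or.inr rfl, by norm_num⟩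
      refine absurd hxe (not_lt.2 ?_)
      rcases hs with ⟨hs, hs'⟩ | ⟨hs, hs'⟩
      · obtain ⟨j, hj, hj', hjc⟩ := edge _ hs'
        have b1 := hbd j hj 1 (by norm_num) (by tauto)
        have b2 := hbd j hj 2 (by norm_num) (by tauto)
        simp only [diamPower, ← hs, hjc] at b1 b2 ⊢
        have := third_mul_add_nonneg (a := e.im) (b := f.im) h3 h4
          (h := (x.re - e.re) * (x.re - e.re)) (by rcases hs' with h | h <;> rw [h] <;> nlinarith)
          (by norm_num at b1; linarith) (by norm_num at b2; linarith)
        linarith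
      · obtain ⟨j, hj, hj', hjc⟩ := edge _ hs'
        have b1 := hbd 1 (by norm_num) j hj (by tauto)
        have b2 := hbd 2 (by norm_num) j hj (by tauto)
        simp only [diamPower, ← hs, hjc] at b1 b2 ⊢
        have := third_mul_add_nonneg (a := e.re) (b := f.re) h1 h2
          (h := (x.im - e.im) * (x.im - e.im)) (by rcases hs' with h | h <;> rw [h] <;> nlinarith)
          (by norm_num at b1; linarith) (by norm_num at b2; linarith)
        linarith
    · exact hef.not_encroaches hsq ((hmem _).2 (Or.inr hx)) (boundaryVertices_subset hx) hxe

theorem lfs_le_dist {P : Finset ℂ} {p q : ℂ} (hp : p ∈ P) (hq : q ∈ P) (h : p ≠ q) :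
    lfs P p ≤ dist p q := by
  refine csInf_le ⟨0, ?_⟩ ⟨p, hp, q, hq, h, by simp, le_rfl⟩
  rintro ρ ⟨a, -, b, -, -, h, -⟩
  exact dist_nonneg.trans h

/-- At a corner this bounds `cUp` from below, which makes the reach at the root cover the whole
square. -/
theorem le_lfs_corner (Ω : Finset ℂ)
    (hΩ : ∀ z ∈ Ω, 1 / 3 ≤ z.re ∧ z.re ≤ 2 / 3 ∧ 1 / 3 ≤ z.im ∧ z.im ≤ 2 / 3)
    (T : Finset Cell) : 1 / 3 ≤ lfs (initState Ω T).vertices 0 := by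
  have hfar : ∀ x ∈ (initState Ω T).vertices, x ≠ 0 → 1 / 3 ≤ dist 0 x := by
    intro x hx hx0
    rw [dist_zero_left]
    have hx : x ∈ Ω ∨ x ∈ boundaryVertices := by simpa [initState] using hx
    rcases hx with hx | hx
    · exact (hΩ x hx).1.trans ((le_abs_self _).trans (Complex.abs_re_le_norm x))
    · obtain ⟨i, hi, j, hj, h, rfl⟩ := (mem_boundaryVertices_iff x).1 hx
      by_cases hi0 : i = 0
      · have hj0 : j ≠ 0 := by
          rintro rfl
          subst hi0
          exact hx0 (Complex.ext (by simp) (by simp))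
        refine le_trans ?_ ((le_abs_self _).trans (Complex.abs_im_le_norm _))
        have : (1 : ℝ) ≤ j := by exact_mod_cast Nat.one_le_iff_ne_zero.2 hj0
        dsimp only
        linarith
      · refine le_trans ?_ ((le_abs_self _).trans (Complex.abs_re_le_norm _))
        have : (1 : ℝ) ≤ i := by exact_mod_cast Nat.one_le_iff_ne_zero.2 hi0
        dsimp only
        linarith
  have hu := unencroached_input Ω hΩ T
  refine le_csInf ⟨1, 0, hu.corner 0 (by simp) (by simp), 1, hu.corner 1 (by simp) (by simp),
    by simp, by simp, by simp⟩ ?_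
  rintro ρ ⟨a, ha, b, hb, hab, h1, h2⟩
  by_cases ha0 : a = 0
  · exact (hfar b hb (fun h => hab (ha0.trans h.symm))).trans h2
  · exact (hfar a ha ha0).trans h1

/-! ### Constants -/

/-- The exponent is at least 2 since an arcsine is at most `π / 2`, and `(2 * β) ^ 2 ≥ 8`. -/
theorem eight_le_cGbu {β : ℝ} (hβ : Real.sqrt 2 ≤ β) : 8 ≤ cGbu β := by
  have h2 : (Real.sqrt 2) ^ 2 = 2 := Real.sq_sqrt zero_le_two
  have h0 := Real.sqrt_nonneg 2
  have hb : 1 ≤ β := by nlinarith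
  have hα : 0 < smallAngle β := Real.arcsin_pos.2 (by positivity)
  have hα2 : smallAngle β ≤ Real.pi / 2 := Real.arcsin_le_pi_div_two _
  have he : (2 : ℝ) ≤ Real.pi / smallAngle β := by
    rw [le_div_iff₀ hα]
    linarith
  calc (8 : ℝ) ≤ (2 * β) ^ (2 : ℝ) := by
        rw [Real.rpow_two]
        nlinarith
    _ ≤ cGbu β := Real.rpow_le_rpow_of_exponent_le (by linarith) he

/-- A storage depth exists unless the distance is too small. -/
theorem exists_isStorageDepth {cLow cUp ρ : ℝ} (hUp : 2 * cLow ≤ cUp) {j : ℕ}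
    (h : cLow * cellSize j ≤ ρ) : ∃ k, IsStorageDepth cLow cUp j ρ k := by
  by_cases hρ : cUp < ρ
  · exact ⟨0, Or.inr ⟨hρ, rfl⟩⟩
  suffices hne : ∃ m, m ≤ j ∧ cLow * cellSize m ≤ ρ ∧ ρ ≤ cUp * cellSize m by
    obtain ⟨m, hm⟩ := hne
    obtain ⟨k, hk⟩ := BddAbove.exists_isGreatest_of_nonempty
      (show BddAbove {m : ℕ | m ≤ j ∧ cLow * cellSize m ≤ ρ ∧ ρ ≤ cUp * cellSize m} from
        ⟨j, fun m hm => hm.1⟩) ⟨m, hm⟩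
    exact ⟨k, Or.inl hk⟩
  -- By `2 * cLow ≤ cUp` the admissible ranges of `ρ` at consecutive depths overlap: a `ρ` too large
  -- for depth `j + 1` is large enough for depth `j`.
  induction j with
  | zero => exact ⟨0, le_rfl, h, by rw [cellSize_zero]; linarith⟩
  | succ j ih =>
    by_cases hj : ρ ≤ cUp * cellSize (j + 1)
    · exact ⟨j + 1, le_rfl, h, hj⟩
    · have h1 := cellSize_succ j
      have h2 := cellSize_pos j
      obtain ⟨m, hm, h3⟩ := ih (by
        push Not at hj
        rw [h1] at hj
        nlinarith)
      exact ⟨m, hm.trans (Nat.le_succ j), h3⟩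

theorem IsStorageDepth.le {cLow cUp ρ : ℝ} (hLow : 0 < cLow) (hUp : 2 * cLow ≤ cUp) {j k : ℕ}
    (h : IsStorageDepth cLow cUp j ρ k) : k ≤ j ∧ cLow * cellSize k ≤ ρ := by
  rcases h with h | ⟨h, rfl⟩
  · exact ⟨h.1.1, h.1.2.1⟩
  · refine ⟨Nat.zero_le j, ?_⟩
    rw [cellSize_zero]
    linarith

/-! ### Packing -/

/-- The number of points of a separated subset of the square is bounded. -/
theorem exists_card_le {δ : ℝ} (hδ : 0 < δ) : ∃ N : ℕ, ∀ P : Finset ℂ, (∀ x ∈ P, x ∈ square) →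
    (∀ p ∈ P, ∀ q ∈ P, p ≠ q → δ ≤ dist p q) → P.card ≤ N := by
  -- In an `M × M` grid, two points of one cell are closer than `2 / M < δ`.
  obtain ⟨M, hM⟩ := exists_nat_gt (2 / δ)
  have hM0 : (0 : ℝ) < M := lt_trans (by positivity) hM
  refine ⟨(Finset.range (M + 1) ×ˢ Finset.range (M + 1)).card, fun P hP hsep => ?_⟩
  have hcell : ∀ x : ℝ, 0 ≤ x → x ≤ 1 → ⌊(M : ℝ) * x⌋₊ < M + 1 := fun x h0 h1 => by
    rw [Nat.lt_succ_iff]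
    exact Nat.floor_le_of_le (by nlinarith)
  have hclose : ∀ x y : ℝ, 0 ≤ x → 0 ≤ y → ⌊(M : ℝ) * x⌋₊ = ⌊(M : ℝ) * y⌋₊ →
      |x - y| < 1 / M := by
    intro x y hx hy h
    have h1 := Nat.floor_le (mul_nonneg hM0.le hx)
    have h2 := Nat.lt_floor_add_one ((M : ℝ) * x)
    have h3 := Nat.floor_le (mul_nonneg hM0.le hy)
    have h4 := Nat.lt_floor_add_one ((M : ℝ) * y)
    rw [h] at h1 h2
    rw [lt_div_iff₀ hM0, ← abs_of_pos hM0, ← abs_mul, abs_lt]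
    constructor <;> nlinarith
  refine Finset.card_le_card_of_injOn (fun z => (⌊(M : ℝ) * z.re⌋₊, ⌊(M : ℝ) * z.im⌋₊)) ?_ ?_
  · intro z hz
    obtain ⟨h1, h2, h3, h4⟩ := hP z hz
    exact Finset.mem_coe.2 (Finset.mem_product.2
      ⟨Finset.mem_range.2 (hcell _ h1 h2), Finset.mem_range.2 (hcell _ h3 h4)⟩)
  · intro z hz w hw h
    by_contra hne
    obtain ⟨h1, h2⟩ := Prod.mk.inj h
    have hz4 := hP z hz
    have hw4 := hP w hw
    have c1 := hclose _ _ hz4.1 hw4.1 h1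
    have c2 := hclose _ _ hz4.2.2.1 hw4.2.2.1 h2
    have hd := hsep z hz w hw hne
    rw [Complex.dist_eq] at hd
    have hn := Complex.norm_le_abs_re_add_abs_im (z - w)
    rw [Complex.sub_re, Complex.sub_im] at hn
    have : 2 / (M : ℝ) < δ := by
      rw [div_lt_iff₀ hδ] at hM
      rw [div_lt_iff₀ hM0]
      linarith
    have e : 2 / (M : ℝ) = 1 / M + 1 / M := by ring
    linarith

/-! ### Invariants of the algorithm -/

/-- What holds in every state of an execution on a quadtree of depth `d`. -/
structure Invariant (β cLow cUp : ℝ) (d : ℕ) (s : State) : Prop where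
  unencroached : Unencroached s.vertices
  level_le : s.level ≤ d
  separated : ∀ p ∈ s.vertices, ∀ q ∈ s.vertices, p ≠ q → cLow * cellSize d ≤ dist p q
  root_mem : Cell.root ∈ s.nodes
  heap_le : ∀ c ∈ s.heap, c.depth ≤ s.level
  mem_heap : ∀ c ∈ s.nodes, c.depth < s.level → c ∈ s.heap
  /-- Every loose pair has a vertex `u`, stored at a depth `k` that suits the length of the pair,
  such that the pair is still to be treated at all levels above, unless it is too long. -/
  untreated : ∀ p q, Loose β s.vertices p q → ∃ u v, ((u = p ∧ v = q) ∨ (u = q ∧ v = p)) ∧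
    ∃ k, cLow * cellSize k ≤ dist p q ∧ ∀ m ≤ k, cellAt m u ∈ s.heap ∨
      cReach β cUp * cellSize m < dist p q ∨ (m = s.level ∧ (u, v) ∈ s.pending)

theorem Loose.symm {β : ℝ} {P : Finset ℂ} {p q : ℂ} (h : Loose β P p q) : Loose β P q p :=
  Or.symm h

theorem Loose.mem {β : ℝ} {P : Finset ℂ} {p q : ℂ} (h : Loose β P p q) :
    p ∈ P ∧ q ∈ P ∧ p ≠ q := by
  rcases h with h | h
  exacts [⟨h.1, h.2.1, h.2.2.1⟩, ⟨h.2.1, h.1, h.2.2.1.symm⟩]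

theorem LooseLeft.anti {β : ℝ} {P Q : Finset ℂ} {p q : ℂ} (h : LooseLeft β Q p q) (hPQ : P ⊆ Q)
    (hp : p ∈ P) (hq : q ∈ P) : LooseLeft β P p q :=
  ⟨hp, hq, h.2.2.1, h.2.2.2.1, fun x hx => h.2.2.2.2 x (hPQ hx)⟩

/-- A pair does not become loose by the insertion of vertices. -/
theorem Loose.anti {β : ℝ} {P Q : Finset ℂ} {p q : ℂ} (h : Loose β Q p q) (hPQ : P ⊆ Q)
    (hp : p ∈ P) (hq : q ∈ P) : Loose β P p q :=
  h.imp (fun h => h.anti hPQ hp hq) (fun h => h.anti hPQ hq hp)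

/-- The leaf containing an endpoint serves as storage cell: `lfs` is at most the length of the pair,
and all ancestors of the leaf are in the heap. -/
theorem invariant_initState {β cLow cUp : ℝ} (hLow : 0 < cLow) (Ω : Finset ℂ)
    (hΩ : ∀ z ∈ Ω, 1 / 3 ≤ z.re ∧ z.re ≤ 2 / 3 ∧ 1 / 3 ≤ z.im ∧ z.im ≤ 2 / 3)
    (T : Finset Cell) (hT : IsQuadtree T)
    (hlfs : ApproximatesLfs T (initState Ω T).vertices cLow cUp) :
    Invariant β cLow cUp (treeDepth T) (initState Ω T) := by
  have hstore : ∀ p ∈ (initState Ω T).vertices, ∀ q ∈ (initState Ω T).vertices, p ≠ q →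
      ∃ k, cellAt k p ∈ T ∧ cLow * cellSize k ≤ dist p q := by
    intro p hp q hq hpq
    obtain ⟨k, hk⟩ := hT.exists_leaf p
    exact ⟨k, hk.1, (hlfs _ hk p hp rfl).1.trans (lfs_le_dist hp hq hpq)⟩
  refine ⟨unencroached_input Ω hΩ T, le_rfl, fun p hp q hq hpq => ?_, hT.root_mem,
    fun c hc => depth_le_treeDepth hc, fun c hc _ => hc, fun p q h => ?_⟩
  · obtain ⟨k, hk, h⟩ := hstore p hp q hq hpq
    refine le_trans ?_ h
    gcongr
    exact cellSize_anti (depth_le_treeDepth hk)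
  · obtain ⟨hp, hq, hpq⟩ := h.mem
    obtain ⟨k, hk, h⟩ := hstore p hp q hq hpq
    exact ⟨p, q, Or.inl ⟨rfl, rfl⟩, k, h, fun m hm => Or.inl (hT.cellAt_mem_of_le hm hk)⟩

theorem cLow_le_cReach {β cLow cUp : ℝ} (hβ : Real.sqrt 2 ≤ β) (hLow : 0 < cLow)
    (hUp : 2 * cLow ≤ cUp) (l : ℕ) : cLow * cellSize l ≤ cReach β cUp * cellSize (l + 1) := by
  have h8 := eight_le_cGbu hβ
  have hs := cellSize_pos l
  rw [cellSize_succ, cReach]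
  have : cLow ≤ cUp * cGbu β := by nlinarith
  nlinarith

/-- Loose pairs are not shorter than the current level allows. -/
theorem Invariant.le_dist {β cLow cUp : ℝ} (hβ : Real.sqrt 2 ≤ β) (hLow : 0 < cLow)
    (hUp : 2 * cLow ≤ cUp) {d : ℕ} {s : State} (hs : Invariant β cLow cUp d s) {l : ℕ}
    (hl : s.pending = ∅ ∨ s.level ≤ l) (hheap : ∀ c ∈ s.heap, c.depth ≤ l) {p q : ℂ}
    (h : Loose β s.vertices p q) : cLow * cellSize l ≤ dist p q := by
  obtain ⟨u, v, -, k, hk, hm⟩ := hs.untreated p q h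
  by_cases hkl : k ≤ l
  · refine le_trans ?_ hk
    gcongr
    exact cellSize_anti hkl
  -- Depth `l + 1` has been finished, so only the reach there can have excluded the pair, and this
  -- makes the pair long.
  · rcases hm (l + 1) (by omega) with h | h | ⟨h, h'⟩
    · exact absurd (hheap _ h) (Nat.not_succ_le_self l)
    · exact (cLow_le_cReach hβ hLow hUp l).trans h.le
    · rcases hl with hl | hl
      · rw [hl] at h'
        exact absurd h' (Finset.notMem_empty _)
      · omega

/-! ### Preservation -/

theorem Invariant.extract {β cLow cUp : ℝ} {d : ℕ} {s : State} (hs : Invariant β cLow cUp d s)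
    {c : Cell} (hp : s.pending = ∅) (hc : c ∈ s.heap) (hmin : ∀ b ∈ s.heap, b.depth ≤ c.depth) :
    Invariant β cLow cUp d (s.extract β cUp c) := by
  classical
  have hcl := hs.heap_le c hc
  refine ⟨hs.unencroached, hcl.trans hs.level_le, hs.separated, hs.root_mem,
    fun b hb => hmin b (Finset.mem_of_mem_erase hb), fun b hb hbc => ?_, fun p q h => ?_⟩
  · refine Finset.mem_erase.2 ⟨?_, hs.mem_heap b hb (lt_of_lt_of_le hbc hcl)⟩
    rintro rfl
    exact lt_irrefl _ hbc
  · obtain ⟨hpm, hqm, hpq⟩ := h.mem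
    obtain ⟨u, v, huv, k, hk, hm⟩ := hs.untreated p q h
    refine ⟨u, v, huv, k, hk, fun m hmk => ?_⟩
    rcases hm m hmk with h | h | ⟨-, h⟩
    -- The only cell that leaves the heap is `c`; its pairs within reach become pending in the order
    -- with `u` first.
    · by_cases hmc : cellAt m u = c
      · by_cases hd : cReach β cUp * cellSize m < dist p q
        · exact Or.inr (Or.inl hd)
        · right; right
          have hmd : m = c.depth := by rw [← hmc]; rfl
          refine ⟨hmd, Finset.mem_filter.2 ?_⟩
          rw [← hmd]
          rcases huv with ⟨rfl, rfl⟩ | ⟨rfl, rfl⟩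
          · exact ⟨Finset.mem_product.2 ⟨hpm, hqm⟩, hmc, hpq, not_lt.1 hd⟩
          · exact ⟨Finset.mem_product.2 ⟨hqm, hpm⟩, hmc, hpq.symm, by
              rw [dist_comm]; exact not_lt.1 hd⟩
      · exact Or.inl (Finset.mem_erase.2 ⟨hmc, h⟩)
    · exact Or.inr (Or.inl h)
    · rw [hp] at h
      exact absurd h (Finset.notMem_empty _)

theorem Invariant.discard {β cLow cUp : ℝ} {d : ℕ} {s : State} (hs : Invariant β cLow cUp d s)
    {p q : ℂ} (hn : ¬ Loose β s.vertices p q) : Invariant β cLow cUp d (s.discard (p, q)) := by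
  classical
  refine ⟨hs.unencroached, hs.level_le, hs.separated, hs.root_mem, hs.heap_le, hs.mem_heap,
    fun a b h => ?_⟩
  obtain ⟨u, v, huv, k, hk, hm⟩ := hs.untreated a b h
  refine ⟨u, v, huv, k, hk, fun m hmk => (hm m hmk).imp_right (Or.imp_right fun h' =>
    ⟨h'.1, Finset.mem_erase.2 ⟨fun he => hn ?_, h'.2⟩⟩)⟩
  obtain ⟨rfl, rfl⟩ := Prod.mk.inj he
  rcases huv with ⟨rfl, rfl⟩ | ⟨rfl, rfl⟩
  exacts [h, h.symm]

/-- The children added for the depths below `k` include the cells of `x` at depths 1 to `k`; the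
root is present anyway. -/
theorem mem_nodes_insert {s : State} {x : ℂ} {k m : ℕ} (hroot : Cell.root ∈ s.nodes)
    (hm : m ≤ k) : cellAt m x ∈ (s.insert x k).nodes := by
  classical
  change _ ∈ s.nodes ∪ (_ \ s.nodes)
  rw [Finset.union_sdiff_self_eq_union, Finset.mem_union]
  cases m with
  | zero => rw [cellAt_zero]; exact Or.inl hroot
  | succ m => exact Or.inr (Finset.mem_biUnion.2
      ⟨m, Finset.mem_range.2 hm, cellAt_succ_mem_children m x⟩)

theorem Invariant.insert {β cLow cUp : ℝ} (hLow : 0 < cLow) {d : ℕ} {s : State}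
    (hs : Invariant β cLow cUp d s) {x : ℂ} {k : ℕ} {ρ : ℝ} (hk : k ≤ s.level)
    (hkρ : cLow * cellSize k ≤ ρ) (hρ : ∀ y ∈ s.vertices, ρ ≤ dist x y)
    (hun : Unencroached (Insert.insert x s.vertices)) :
    Invariant β cLow cUp d (s.insert x k) := by
  classical
  have hvert : ∀ y, y ∈ (s.insert x k).vertices ↔ y = x ∨ y ∈ s.vertices :=
    fun y => Finset.mem_insert
  have hheap : s.heap ⊆ (s.insert x k).heap := fun c hc =>
    Finset.mem_union_left _ (Finset.mem_union_left _ hc)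
  have hmem : ∀ c ∈ (s.insert x k).nodes, c.depth < s.level → c ∈ (s.insert x k).heap := by
    intro c hc hcl
    rcases Finset.mem_union.1 hc with hc | hc
    · exact hheap (hs.mem_heap c hc hcl)
    · exact Finset.mem_union_left _ (Finset.mem_union_right _ hc)
  have hd : cLow * cellSize d ≤ ρ := by
    refine le_trans ?_ hkρ
    gcongr
    exact cellSize_anti (hk.trans hs.level_le)
  refine ⟨hun, hs.level_le, fun p hp q hq hpq => ?_, Finset.mem_union_left _ hs.root_mem,
    fun c hc => ?_, hmem, fun p q h => ?_⟩
  · rcases (hvert p).1 hp with rfl | hp' <;> rcases (hvert q).1 hq with rfl | hq'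
    · exact absurd rfl hpq
    · exact hd.trans (hρ q hq')
    · rw [dist_comm]
      exact hd.trans (hρ p hp')
    · exact hs.separated p hp' q hq' hpq
  · change c.depth ≤ s.level
    rcases Finset.mem_union.1 hc with hc | hc
    · rcases Finset.mem_union.1 hc with hc | hc
      · exact hs.heap_le c hc
      · obtain ⟨m, hm, hc⟩ := Finset.mem_biUnion.1 (Finset.mem_sdiff.1 hc).1
        rw [depth_of_mem_children hc]
        exact (Nat.succ_le_of_lt (Finset.mem_range.1 hm)).trans hk
    · split_ifs at hc with h
      · rw [Finset.mem_singleton.1 hc]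
        exact hk
      · exact absurd hc (Finset.notMem_empty _)
  -- Above the current level all nodes are in the heap, including the new ones. A cell in the
  -- current level occurs only for `m = k` and is put back explicitly.
  · have hnew : ∀ m ≤ k, cellAt m x ∈ (s.insert x k).heap := by
      intro m hm
      rcases (hm.trans hk).lt_or_eq with hml | hml
      · exact hmem _ (mem_nodes_insert hs.root_mem hm) hml
      · have hkl : k = s.level := le_antisymm hk (hml ▸ hm)
        refine Finset.mem_union_right _ ?_
        rw [if_pos hkl, Finset.mem_singleton, hml, hkl]
    obtain ⟨hp, hq, hpq⟩ := h.mem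
    rcases (hvert p).1 hp with rfl | hp'
    · have hq' := ((hvert q).1 hq).resolve_left hpq.symm
      exact ⟨p, q, Or.inl ⟨rfl, rfl⟩, k, hkρ.trans (hρ q hq'), fun m hm => Or.inl (hnew m hm)⟩
    rcases (hvert q).1 hq with rfl | hq'
    · exact ⟨q, p, Or.inr ⟨rfl, rfl⟩, k, by rw [dist_comm]; exact hkρ.trans (hρ p hp'),
        fun m hm => Or.inl (hnew m hm)⟩
    · obtain ⟨u, v, huv, j, hj, hm⟩ :=
        hs.untreated p q (h.anti (Finset.subset_insert _ _) hp' hq')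
      exact ⟨u, v, huv, j, hj, fun m hmj => (hm m hmj).imp_left fun h => hheap h⟩

theorem one_half_lt_of_sqrt_two_le {β : ℝ} (hβ : Real.sqrt 2 ≤ β) : 1 / 2 < β := by
  have : (1 : ℝ) ≤ Real.sqrt 2 := Real.one_le_sqrt.2 one_le_two
  linarith

/-- The disk centred at an off-centre through the pair contains no vertex in its interior, and it
is large. -/
theorem Invariant.offCenter {β cLow cUp : ℝ} (hβ : Real.sqrt 2 ≤ β) (hLow : 0 < cLow)
    (hUp : 2 * cLow ≤ cUp) {d : ℕ} {s : State} (hs : Invariant β cLow cUp d s) {a b r : ℂ}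
    (hl : LooseLeft β s.vertices a b) (hr : IsOffCenter β s.vertices a b r) :
    0 < cross a b r ∧ dist r a = dist r b ∧ (∀ x ∈ s.vertices, dist r a ≤ dist r x) ∧
      Real.sqrt 2 * (cLow * cellSize s.level) ≤ dist r a := by
  have hβ' := one_half_lt_of_sqrt_two_le hβ
  obtain ⟨t, ht, rfl, he⟩ := hr.exists_axisPoint hβ' hl
  refine ⟨?_, (axisPoint_dist_right t a b).symm, he, ?_⟩
  · rw [cross_axisPoint]
    exact mul_pos ((leafHeight_pos hβ').trans_le ht) (pow_pos (dist_pos.2 hl.2.2.1) 2)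
  · refine le_trans ?_ (mul_dist_le_axisPoint_dist hβ' ht a b)
    exact mul_le_mul hβ (hs.le_dist hβ hLow hUp (Or.inr le_rfl) hs.heap_le (Or.inl hl))
      (mul_nonneg hLow.le (cellSize_pos _).le) (by linarith)

theorem dist_eq_of_pair {p q a b r : ℂ} (hab : (a = p ∧ b = q) ∨ (a = q ∧ b = p))
    (h : dist r a = dist r b) : dist p r = dist r a := by
  rw [dist_comm]
  rcases hab with ⟨rfl, rfl⟩ | ⟨rfl, rfl⟩
  exacts [rfl, h.symm]

theorem IsBoundarySegment.le_dist_midpoint {P : Finset ℂ} (hP : Unencroached P) {e f : ℂ}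
    (h : IsBoundarySegment P e f) {x : ℂ} (hx : x ∈ P) :
    dist e f / 2 ≤ dist ((e + f) / 2) x := by
  rw [dist_comm _ x]
  exact not_lt.1 (hP.not_encroaches x hx e f h)

/-- Every step preserves the invariant, and adds a vertex or shrinks the heap or the list of
pending pairs. -/
theorem Invariant.step {β cLow cUp : ℝ} (hβ : Real.sqrt 2 ≤ β) (hLow : 0 < cLow)
    (hUp : 2 * cLow ≤ cUp) {d : ℕ} {s s' : State} (hs : Invariant β cLow cUp d s)
    (h : Step β cLow cUp s s') : Invariant β cLow cUp d s' ∧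
      (s.vertices.card < s'.vertices.card ∨ s'.vertices = s.vertices ∧
        (s'.heap.card < s.heap.card ∨ s'.heap = s.heap ∧ s'.pending.card < s.pending.card)) := by
  classical
  have hgrow : ∀ {x : ℂ} {k : ℕ} {ρ : ℝ}, k ≤ s.level → cLow * cellSize k ≤ ρ →
      (∀ y ∈ s.vertices, ρ ≤ dist x y) →
      s.vertices.card < (s.insert x k).vertices.card := by
    intro x k ρ hk hkρ hρ
    have hx : x ∉ s.vertices := fun hx => by
      have h1 := hρ x hx
      rw [dist_self] at h1
      have := mul_pos hLow (cellSize_pos k)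
      linarith
    change _ < (Insert.insert x s.vertices).card
    rw [Finset.card_insert_of_notMem hx]
    exact Nat.lt_succ_self _
  cases h with
  | extract c hp hc hmin =>
    exact ⟨hs.extract hp hc hmin, Or.inr ⟨rfl, Or.inl (Finset.card_erase_lt_of_mem hc)⟩⟩
  | discard p q hpq hn =>
    exact ⟨hs.discard hn, Or.inr ⟨rfl, Or.inr ⟨rfl, Finset.card_erase_lt_of_mem hpq⟩⟩⟩
  | insert p q a b r k hpq hab hl hr hfree hk =>
    obtain ⟨h1, h2, h3, h4⟩ := hs.offCenter hβ hLow hUp hl hr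
    rw [dist_eq_of_pair hab h2] at hk
    obtain ⟨hk1, hk2⟩ := hk.le hLow hUp
    obtain ⟨hr1, hr2⟩ := hs.unencroached.mem_interior hl.1 hl.2.1 hl.2.2.1 hl.2.2.2.1 h1 h2 h3
      hfree
    exact ⟨hs.insert hLow hk1 hk2 h3 (hs.unencroached.insert hr1 hr2 hfree),
      Or.inl (hgrow hk1 hk2 h3)⟩
  | split p q a b r e f k hpq hab hl hr hef henc hk =>
    obtain ⟨hk1, hk2⟩ := hk.le hLow hUp
    have h3 := fun x hx => hef.le_dist_midpoint hs.unencroached (x := x) hx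
    exact ⟨hs.insert hLow hk1 hk2 h3 (hs.unencroached.insert_midpoint hef),
      Or.inl (hgrow hk1 hk2 h3)⟩

/-! ### Progress, termination and the final state -/

theorem Invariant.exists_step {β cLow cUp : ℝ} (hβ : Real.sqrt 2 ≤ β) (hLow : 0 < cLow)
    (hUp : 2 * cLow ≤ cUp) {d : ℕ} {s : State} (hs : Invariant β cLow cUp d s) :
    s.Final ∨ ∃ s', Step β cLow cUp s s' := by
  rcases s.pending.eq_empty_or_nonempty with hp | ⟨⟨p, q⟩, hpq⟩
  · rcases s.heap.eq_empty_or_nonempty with hh | hh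
    · exact Or.inl ⟨hh, hp⟩
    · obtain ⟨c, hc, hmin⟩ := Finset.exists_max_image s.heap Cell.depth hh
      exact Or.inr ⟨_, Step.extract s c hp hc hmin⟩
  right
  by_cases hn : Loose β s.vertices p q
  · obtain ⟨a, b, hab, hl⟩ : ∃ a b, ((a = p ∧ b = q) ∨ (a = q ∧ b = p)) ∧
        LooseLeft β s.vertices a b := by
      rcases hn with h | h
      exacts [⟨p, q, Or.inl ⟨rfl, rfl⟩, h⟩, ⟨q, p, Or.inr ⟨rfl, rfl⟩, h⟩]
    obtain ⟨r, hr⟩ := hl.exists_isOffCenter (one_half_lt_of_sqrt_two_le hβ)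
    obtain ⟨h1, h2, h3, h4⟩ := hs.offCenter hβ hLow hUp hl hr
    have hc : 0 ≤ cLow * cellSize s.level := mul_nonneg hLow.le (cellSize_pos _).le
    have h2' : (1 : ℝ) ≤ Real.sqrt 2 := Real.one_le_sqrt.2 one_le_two
    by_cases hfree : ∀ e f, IsBoundarySegment s.vertices e f → ¬ Encroaches r e f
    · obtain ⟨k, hk⟩ := exists_isStorageDepth (cLow := cLow) (cUp := cUp) (ρ := dist p r) hUp
        (j := s.level) (by rw [dist_eq_of_pair hab h2]; nlinarith)
      exact ⟨_, Step.insert s p q a b r k hpq hab hl hr hfree hk⟩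
    · push Not at hfree
      obtain ⟨e, f, hef, henc⟩ := hfree
      have h5 := henc.radius_le dist_nonneg (h3 e hef.1) (h3 f hef.2.1)
      obtain ⟨k, hk⟩ := exists_isStorageDepth (cLow := cLow) (cUp := cUp) (ρ := dist e f / 2) hUp
        -- The factor `√2` gained from `β` cancels the one lost by splitting the segment.
        (j := s.level) (le_of_mul_le_mul_left (h4.trans h5) (by linarith))
      exact ⟨_, Step.split s p q a b r e f k hpq hab hl hr hef henc hk⟩
  · exact ⟨_, Step.discard s p q hpq hn⟩

theorem Invariant.of_reachable {β cLow cUp : ℝ} (hβ : Real.sqrt 2 ≤ β) (hLow : 0 < cLow)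
    (hUp : 2 * cLow ≤ cUp) {d : ℕ} {s s' : State} (hs : Invariant β cLow cUp d s)
    (h : Relation.ReflTransGen (Step β cLow cUp) s s') : Invariant β cLow cUp d s' := by
  induction h with
  | refl => exact hs
  | tail _ h ih => exact (ih.step hβ hLow hUp h).1

/-- There is no infinite execution. -/
theorem Invariant.terminates {β cLow cUp : ℝ} (hβ : Real.sqrt 2 ≤ β) (hLow : 0 < cLow)
    (hUp : 2 * cLow ≤ cUp) {d : ℕ} {s : State} (hs : Invariant β cLow cUp d s) :
    ¬ ∃ run : ℕ → State, run 0 = s ∧ ∀ n, Step β cLow cUp (run n) (run (n + 1)) := by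
  rintro ⟨run, rfl, hrun⟩
  have hinv : ∀ n, Invariant β cLow cUp d (run n) := by
    intro n
    induction n with
    | zero => exact hs
    | succ n ih => exact (ih.step hβ hLow hUp (hrun n)).1
  obtain ⟨N, hN⟩ := exists_card_le (mul_pos hLow (cellSize_pos d))
  have hcard : ∀ n, (run n).vertices.card ≤ N := fun n =>
    hN _ (hinv n).unencroached.mem_square (hinv n).separated
  -- Lexicographic descent: insertion may enlarge the heap and extraction the pending list, but the
  -- number of vertices is bounded by `N` and never falls.
  refine not_strictAnti_of_wellFoundedLT (fun n => toLex (N - (run n).vertices.card,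
    toLex ((run n).heap.card, (run n).pending.card))) (strictAnti_nat_of_succ_lt fun n => ?_)
  rw [Prod.Lex.toLex_lt_toLex]
  have h1 := hcard n
  have h2 := hcard (n + 1)
  rcases ((hinv n).step hβ hLow hUp (hrun n)).2 with h | ⟨h, h'⟩
  · left
    dsimp only
    omega
  · right
    refine ⟨by dsimp only; rw [h], ?_⟩
    rw [Prod.Lex.toLex_lt_toLex]
    rcases h' with h' | ⟨h', h''⟩
    exacts [Or.inl h', Or.inr ⟨congrArg Finset.card h', h''⟩]

theorem dist_le_two_of_mem_square {p q : ℂ} (hp : p ∈ square) (hq : q ∈ square) :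
    dist p q ≤ 2 := by
  obtain ⟨a1, a2, a3, a4⟩ := hp
  obtain ⟨b1, b2, b3, b4⟩ := hq
  rw [Complex.dist_eq]
  refine (Complex.norm_le_abs_re_add_abs_im _).trans ?_
  rw [Complex.sub_re, Complex.sub_im]
  have h1 : |p.re - q.re| ≤ 1 := abs_le.2 ⟨by linarith, by linarith⟩
  have h2 : |p.im - q.im| ≤ 1 := abs_le.2 ⟨by linarith, by linarith⟩
  linarith

/-- The invariant is applied at the root: nothing is scheduled there any more, and no pair exceeds
the reach. -/
theorem Invariant.not_loose_of_final {β cLow cUp : ℝ} {d : ℕ} {s : State}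
    (hs : Invariant β cLow cUp d s) (hreach : 2 ≤ cReach β cUp) (hf : s.Final) (p q : ℂ) :
    ¬ Loose β s.vertices p q := by
  intro h
  obtain ⟨u, v, -, k, -, hm⟩ := hs.untreated p q h
  obtain ⟨hp, hq, -⟩ := h.mem
  rcases hm 0 (Nat.zero_le k) with h | h | ⟨-, h⟩
  · rw [hf.1] at h
    exact absurd h (Finset.notMem_empty _)
  · rw [cellSize_zero] at h
    have := dist_le_two_of_mem_square (hs.unencroached.mem_square p hp)
      (hs.unencroached.mem_square q hq)
    linarith
  · rw [hf.2] at h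
    exact absurd h (Finset.notMem_empty _)

theorem two_le_cReach {β cLow cUp : ℝ} (hβ : Real.sqrt 2 ≤ β) (Ω : Finset ℂ)
    (hΩ : ∀ z ∈ Ω, 1 / 3 ≤ z.re ∧ z.re ≤ 2 / 3 ∧ 1 / 3 ≤ z.im ∧ z.im ≤ 2 / 3)
    (T : Finset Cell) (hT : IsQuadtree T) (hUp : 0 ≤ cUp)
    (hlfs : ApproximatesLfs T (initState Ω T).vertices cLow cUp) : 2 ≤ cReach β cUp := by
  obtain ⟨k, hk⟩ := hT.exists_leaf 0
  have h0 := (unencroached_input Ω hΩ T).corner 0 (by simp) (by simp)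
  have h1 := (hlfs _ hk 0 h0 rfl).2
  have h2 := le_lfs_corner Ω hΩ T
  have h3 : cUp * cellSize (cellAt k 0).depth ≤ cUp :=
    mul_le_of_le_one_right hUp (cellSize_le_one _)
  have h4 := eight_le_cGbu hβ
  rw [cReach]
  nlinarith

end QTRefine

end

theorem mainTheorem4 (β : ℝ) (hβ : Real.sqrt 2 ≤ β)
    (Ω : Finset ℂ)
    (hΩ : ∀ z ∈ Ω, 1 / 3 ≤ z.re ∧ z.re ≤ 2 / 3 ∧ 1 / 3 ≤ z.im ∧ z.im ≤ 2 / 3)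
    (T : Finset QTRefine.Cell) (hT : QTRefine.IsQuadtree T) (hbal : QTRefine.IsBalanced T)
    (cLow cUp cShrink : ℝ) (hLow : 0 < cLow) (hUp : 2 * cLow ≤ cUp)
    (hlfs : QTRefine.ApproximatesLfs T (QTRefine.initState Ω T).vertices cLow cUp)
    (hShrink : 0 < cShrink) (hShrink1 : cShrink ≤ 1) :
    (¬ ∃ run : ℕ → QTRefine.State, run 0 = QTRefine.initState Ω T ∧
      ∀ n, QTRefine.Step β cLow cUp (run n) (run (n + 1))) ∧
    ∀ s : QTRefine.State, QTRefine.Reachable β cLow cUp Ω T s →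
      (s.Final ∨ ∃ s', QTRefine.Step β cLow cUp s s') ∧
      (∀ i : ℕ, i ≤ QTRefine.treeDepth T → s.AtStage (QTRefine.treeDepth T) i →
        ∀ p q : ℂ, QTRefine.Loose β s.vertices p q →
          cShrink * cLow / 2 ^ (QTRefine.treeDepth T - i + 1) ≤ dist p q) ∧
      (s.Final →
        (∀ p q : ℂ, ¬ QTRefine.Loose β s.vertices p q) ∧
        (∀ p q r : ℂ, QTRefine.IsDelaunayTriangle s.vertices p q r →
          ¬ QTRefine.IsBadTriangle β p q r)) := by
  have hinit := QTRefine.invariant_initState (β := β) hLow Ω hΩ T hT hlfs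
  refine ⟨hinit.terminates hβ hLow hUp, fun s hreach => ?_⟩
  have hs := hinit.of_reachable hβ hLow hUp hreach
  refine ⟨hs.exists_step hβ hLow hUp, fun i _ hstage p q h => ?_, fun hf => ?_⟩
  -- The bound from the invariant is `cLow / 2 ^ (treeDepth T - i)`; the exponent `+ 1` and the
  -- factor `cShrink ≤ 1` only weaken it.
  · refine le_trans ?_ (hs.le_dist hβ hLow hUp (Or.inl hstage.1) hstage.2 h)
    rw [QTRefine.cellSize, mul_one_div, pow_succ]
    have h1 : (0 : ℝ) < 2 ^ (QTRefine.treeDepth T - i) := by positivity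
    exact div_le_div₀ hLow.le (by nlinarith) h1 (by linarith)
  · have hno := hs.not_loose_of_final
      (QTRefine.two_le_cReach hβ Ω hΩ T hT (by linarith) hlfs) hf
    exact ⟨hno, fun p q r => QTRefine.not_isBadTriangle_of_no_loose
      (QTRefine.one_half_lt_of_sqrt_two_le hβ) hs.unencroached.mem_square hno⟩
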